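/- **Setting.** A rational space $(X,\Lambda)$ with a rational inner product $Q$ is a finite-dimensional real vector space $X$ with a lattice $\Lambda$ and an inner product $Q$ with $Q(x,y)\in\mathbb{Q}$ for all $x,y\in\Lambda$. A subspace $L\subset X$ is rational if $L\cap\Lambda$ is a lattice in $L$; then $X/L$ is identified with the orthogonal complement $L^{\perp}$, with the induced inner product and the orthogonal projection of $\Lambda$ as its lattice, and $p_L:X^*\to (X/L)^*$ is the restriction of functionals to $L^\perp$. A cone is unimodular if it is generated by a subset of a $\mathbb{Z}$-basis of the lattice. For a cone $C$, $L(C)$ is its linear span, $\dim C=\dim L(C)$, and $\mathcal{F}(C)$ is the set of its (non-empty) faces; for $F\in\mathcal{F}(C)$, $\pi_F(C)$ is the image of $C$ in $X/L(F)$. Integrals over $F$ use the Lebesgue measure on $L(F)$ for which a fundamental domain of the lattice of $L(F)$ (the intersection of $L(F)$ with the lattice of the ambient space) has measure $1$. The symbol of a differential operator $D$ with constant coefficients is $\sigma(D)(\xi)=e^{-\langle\xi,x\rangle}D e^{\langle\xi,x\rangle}$, $\xi\in X^*$. For a function $\varphi$ on $X$, put $R_N(C;\varphi)=N^{-\dim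 C}\sum_{\gamma\in C\cap\Lambda}\varphi(\gamma/N)$. The numbers $b_n$ are defined by $\frac{z}{e^z-1}=\sum_{n\ge 0}\frac{b_n}{n!}z^n$. **Berline–Vergne functions.** For a rational space $X$ with a rational inner product, the Berline–Vergne functions of unimodular cones are the germs at $0$ of real-analytic functions $\mu_{X/L}(C)$ on $(X/L)^*$, for $L$ a rational subspace of $X$ and $C$ a unimodular cone in $X/L$, such that $\mu_{\{0\}}(\{0\})=1$ and $$\sum_{\gamma\in C\cap\Lambda_{X/L}}e^{\langle\xi,\gamma\rangle}=\sum_{F\in\mathcal{F}(C)}\mu_{(X/L)/L(F)}(\pi_F(C))(p_{L(F)}\xi)\int_F e^{\langle\xi,x\rangle}\,dx ,$$ where $\Lambda_{X/L}$ is the lattice of $X/L$. This is an identity of meromorphic functions near $0\in(X/L)^*$; equivalently, it holds for all $\xi$ close to $0$ with $\langle\xi,x\rangle<0$ for every $x\in C\setminus\{0\}$, where the sum and the integrals converge absolutely. Let $\mu^k_{X/L}(C)$ be the homogeneous part of degree $k$ of the Taylor expansion of $\mu_{X/L}(C)$ at $0$, and $\mu^k_X(C)=p_L^*\mu^k_{X/L}(C)$.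 **Theorem.** Suppose that for every rational space $(X,\Lambda)$ with a rational inner product, every rational subspace $L$ of $X$, every unimodular cone $C$ in $X/L$ and every integer $n\ge\dim C$ there is given a homogeneous differential operator $\mathcal{D}_n^X(C)$ on $X$ with constant (complex) coefficients, of order $n-\dim C$ and with symbol $\nu_n^X(C)$, such that (a cone in $X$ is a cone in $X/L$ with $L=\{0\}$): 1. if $C\subset X/L$, then $\nu_n^X(C)=p_L^*\,\nu_n^{X/L}(C)$; 2. if $C\subset X$ and $\dim C<\dim X$, then $\nu_n^X(C)$ is the pullback of $\nu_n^{L(C)}(C)$ under the restriction map $X^*\to L(C)^*$, where $L(C)$ carries the lattice $L(C)\cap\Lambda$ and the restricted inner product; 3. if $\dim X=0$, then $\mathcal{D}_0^X(\{0\})=1$ and $\mathcal{D}_n^X(\{0\})=0$ for $n\ge1$; if $\dim X=1$ and $C=\mathbb{R}_+u$ with a generator $u$ of $\Lambda$, then $\mathcal{D}_n^X(C)=-\frac{b_n}{n!}\nabla_u^{n-1}$ for $n\ge1$; 4. for every unimodular cone $C\subset X$ and every Schwartz function $\varphi\in\mathcal{S}(X)$, $$R_N(C;\varphi)\sim\sum_{n\ge0}N^{-n}\sum_{F\in\mathcal{F}(C),\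 \dim F\ge\dim C-n}\int_F\mathcal{D}_n^X(\pi_F(C))\varphi\qquad(N\to\infty).$$ Then, for every such $X$, the Berline–Vergne functions of unimodular cones exist, and they satisfy $$\nu_n^X(C)=\mu_X^{\,n-\dim C}(C)$$ for every rational subspace $L$ of $X$, every unimodular cone $C$ in $X/L$ and every $n\ge\dim C$. -/

import Mathlib

open Filter Topology MeasureTheory
open scoped ContDiff

universe u

noncomputable section

namespace EulerMaclaurin

/-! Rational spaces. A rational space with a rational inner product is a finite-dimensional real
inner product space `X` (its inner product is `Q`) together with a lattice `Λ`. The quotient `X / L`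
is identified, as always below, with the orthogonal complement `Lᗮ`; its lattice is then the
orthogonal projection of `Λ`, and the projection `p_L` from `X*` to `(X / L)*` is the restriction of
functionals to `Lᗮ`. -/

section Lattices

variable {X : Type u} [NormedAddCommGroup X] [InnerProductSpace ℝ X] [FiniteDimensional ℝ X]

/-- `Λ` is a lattice in `X` and the inner product of `X` is rational with respect to `Λ`. -/
structure IsRationalSpace (Λ : Submodule ℤ X) : Prop where
  discrete : DiscreteTopology Λ
  span_eq_top : Submodule.span ℝ (Λ : Set X) = ⊤
  inner_rational : ∀ x ∈ Λ, ∀ y ∈ Λ, ∃ q : ℚ, inner ℝ x y = (q : ℝ)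

/-- The subspace `L` is rational: `L ∩ Λ` is a lattice in `L`. -/
def IsRationalSubspace (Λ : Submodule ℤ X) (L : Submodule ℝ X) : Prop :=
  Submodule.span ℝ {x : X | x ∈ Λ ∧ x ∈ L} = L

/-- The orthogonal projection of `X` onto `Lᗮ ≅ X / L`, as a map from `X` to itself. -/
def perpProj (L : Submodule ℝ X) : X →ₗ[ℝ] X := (Lᗮ.starProjection : X →ₗ[ℝ] X)

/-- The lattice of `X / L ≅ Lᗮ`: the orthogonal projection of `Λ`, as a subgroup of `X`. -/
def quotLattice (Λ : Submodule ℤ X) (L : Submodule ℝ X) : Submodule ℤ X :=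
  Λ.map ((perpProj L).restrictScalars ℤ)

/-- The subgroup `M ∩ K` of the subspace `K`. -/
def latticeIn (M : Submodule ℤ X) (K : Submodule ℝ X) : Submodule ℤ K :=
  M.comap (K.subtype.restrictScalars ℤ)

/-- `∫_A g` with respect to the Lebesgue measure on `X` for which a fundamental domain of the
lattice `M` has measure `1`. -/
def latticeIntegral {G : Type*} [NormedAddCommGroup G] [NormedSpace ℝ G]
    (M : Submodule ℤ X) (A : Set X) (g : X → G) : G :=
  letI : MeasurableSpace X := borel X
  haveI : BorelSpace X := ⟨rfl⟩
  ∫ x in A, g x ∂((ENNReal.ofReal (ZLattice.covolume M volume))⁻¹ • (volume : Measure X))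

end Lattices

/-! Cones. A `PointedCone` of Mathlib is a convex cone that contains the origin. -/

section Cones

variable {X : Type u} [NormedAddCommGroup X] [InnerProductSpace ℝ X] [FiniteDimensional ℝ X]

/-- `L(C)`, the linear span of the cone `C`. -/
def coneSpan (C : PointedCone ℝ X) : Submodule ℝ X := Submodule.span ℝ (C : Set X)

/-- The dimension of the cone `C`. -/
def coneDim (C : PointedCone ℝ X) : ℕ := Module.finrank ℝ (coneSpan C)

/-- `C` is unimodular: it is generated by a subset of a `ℤ`-basis of `M`. -/
def IsUnimodular (M : Submodule ℤ X) (C : PointedCone ℝ X) : Prop :=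
  ∃ (k : ℕ) (b : Module.Basis (Fin k) ℤ M) (s : Set (Fin k)),
    C = PointedCone.hull ℝ ((fun i => (b i : X)) '' s)

/-- The cone `C ∩ K`, as a cone in the subspace `K`. -/
def coneIn (C : PointedCone ℝ X) (K : Submodule ℝ X) : PointedCone ℝ K := C.comap K.subtype

/-- `∫_F g` over the cone `F`, for the Lebesgue measure on `L(F)` normalized by `M ∩ L(F)`. -/
def coneIntegral {G : Type*} [NormedAddCommGroup G] [NormedSpace ℝ G]
    (M : Submodule ℤ X) (F : PointedCone ℝ X) (g : X → G) : G :=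
  latticeIntegral (latticeIn M (coneSpan F)) (coneIn F (coneSpan F) : Set (coneSpan F))
    (fun x => g x)

/-- The Riemann sum `R_N(C; φ) = N ^ (- dim C) ∑_{γ ∈ NC ∩ Λ} φ(γ / N)`, where `NC = C`. -/
def riemannSum (Λ : Submodule ℤ X) (C : PointedCone ℝ X) (φ : X → ℂ) (N : ℕ) : ℂ :=
  ((N : ℂ) ^ coneDim C)⁻¹ * ∑' γ : {γ : X // γ ∈ Λ ∧ γ ∈ C}, φ ((N : ℝ)⁻¹ • (γ : X))

end Cones

/-! Differential operators with constant coefficients. -/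

section Operators

variable {X : Type u} [NormedAddCommGroup X] [InnerProductSpace ℝ X] [FiniteDimensional ℝ X]

/-- `D` is a homogeneous differential operator of order `k` with constant (complex) coefficients:
a linear combination of the operators `∇_{u₁} ⋯ ∇_{u_k}`. -/
def IsHomogeneousOperator (k : ℕ) (D : (X → ℂ) → X → ℂ) : Prop :=
  D ∈ Submodule.span ℂ (Set.range fun (v : Fin k → X) (f : X → ℂ) (x : X) =>
    iteratedFDeriv ℝ k f x v)

/-- The symbol `σ(D)(ξ) = e_{-ξ} D e_ξ`, where `e_ξ(x) = exp ⟨ξ, x⟩`; for an operator with constant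
coefficients this is a constant function, which is evaluated at the origin. -/
def symbol (D : (X → ℂ) → X → ℂ) (ξ : StrongDual ℝ X) : ℂ :=
  D (fun x => Complex.exp (ξ x : ℂ)) 0

/-- `a N ∼ ∑_{n ≥ 0} N ^ (-n) c n` as `N → ∞`. -/
def HasAsymptoticExpansion (a c : ℕ → ℂ) : Prop :=
  ∀ K : ℕ, (fun N : ℕ => a N - ∑ n ∈ Finset.range K, ((N : ℂ) ^ n)⁻¹ * c n)
    =O[atTop] fun N : ℕ => ((N : ℝ) ^ K)⁻¹

/-- The homogeneous part of degree `k` of the Taylor expansion of `f` at the origin. -/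
def homogeneousPart {E : Type*} [NormedAddCommGroup E] [NormedSpace ℝ E] (k : ℕ) (f : E → ℝ)
    (ξ : E) : ℝ :=
  (k.factorial : ℝ)⁻¹ * iteratedFDeriv ℝ k f 0 (fun _ => ξ)

end Operators

section BerlineVergne

variable {X : Type u} [NormedAddCommGroup X] [InnerProductSpace ℝ X] [FiniteDimensional ℝ X]

/-- The family `μ L C = μ_{X/L}(C)`, for the rational subspaces `L` of `X` and the unimodular cones
`C` in `X / L`, is the family of Berline–Vergne functions. Each `μ L C` is a germ at the origin of an
analytic function on `(X / L)* ≅ (Lᗮ)*`; it is `1` when `X / L` and `C` are zero, and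
`∑_{γ ∈ C ∩ p_L(Λ)} e^⟨ξ,γ⟩ = ∑_F μ_{X/(L+L(F))}(π_F(C))(ξ) ∫_F e^⟨ξ,x⟩ dx`,
where `F` runs through the faces of `C` and `π_F(C)` is the transverse cone of `C` along `F`. Both
sides are meromorphic near the origin, so the identity is required on the open set of those `ξ` near
`0` that are negative on `C \ {0}`, where the sum and the integrals converge absolutely. -/
structure IsBerlineVergneFamily (Λ : Submodule ℤ X)
    (μ : (L : Submodule ℝ X) → PointedCone ℝ X → StrongDual ℝ Lᗮ → ℝ) : Prop where
  analytic : ∀ (L : Submodule ℝ X) (C : PointedCone ℝ X), IsRationalSubspace Λ L →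
    IsUnimodular (quotLattice Λ L) C → AnalyticAt ℝ (μ L C) 0
  zero_space : μ ⊤ ⊥ 0 = 1
  sum_eq : ∀ (L : Submodule ℝ X) (C : PointedCone ℝ X), IsRationalSubspace Λ L →
    IsUnimodular (quotLattice Λ L) C →
    ∀ᶠ ξ : StrongDual ℝ X in 𝓝 0, (∀ x ∈ C, x ≠ 0 → ξ x < 0) →
      ∑' γ : {γ : X // γ ∈ quotLattice Λ L ∧ γ ∈ C}, Real.exp (ξ (γ : X)) =
        ∑ᶠ (F : PointedCone ℝ X) (_ : F.IsFaceOf C),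
          μ (L ⊔ coneSpan F) (C.map (perpProj (L ⊔ coneSpan F)))
              (ξ ∘L (L ⊔ coneSpan F)ᗮ.subtypeL) *
            coneIntegral (quotLattice Λ L) F (fun x => Real.exp (ξ x))

end BerlineVergne

end EulerMaclaurin

end

open EulerMaclaurin

/-! Both families of functions satisfy one and the same recursion, and the recursion has only one
solution. Let `C` be generated by the part `v i`, `i ∈ s`, of a lattice basis; its faces are
generated by the subsets `t ⊆ s`. Condition 4 is tested on an exponential: if `ξ` is negative on `C
\ {0}`, some Schwartz function equals `e^ξ` near `C` (`exists_schwartzMap_eq_cexp`). The Riemann sum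
is then a product of geometric series, namely `∏ (-ξ(v i))⁻¹` times the value at `ξ/N` of the Todd
product of the `z/(e^z - 1)`, `z = ξ(v i)`. On the other side, the operator of a face acts on `e^ξ`
by its symbol, and the face has integral `∏_{i ∈ t} (-ξ(v i))⁻¹`. Comparing coefficients of `N⁻ⁿ`
gives `∑_t ν_n(π_t C)(ξ) ∏_{i ∈ s \ t} (-ξ(v i)) = Todd_n(ξ)`. The term `t = ∅` contains the symbol
of `C` itself, the others only cones of smaller dimension. By analyticity the identity extends to
all `ξ`.

The Berline–Vergne identity, multiplied by `∏_{i ∈ s} (-ξ(v i))`, becomes the same relation for `μ`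
without the grading (`tsum_exp_eq_finsum_iff`), and its degree `n` part is the recursion above.
Induction on `dim C` yields the equality of symbols and homogeneous parts.

Condition 4 concerns cones in a space itself, so for `X / L` the recursion is applied in `Lᗮ` and
carried back by condition 1. This requires comparing an orthogonal complement inside `Lᗮ` with one
inside `X`; the two are isometric, and the recursion itself forces the symbols to be invariant under
such isometries (`symbolInvariant`).

Existence of `μ` amounts to convergence of the sum over `n` of the symbols. Inductively, the Todd
product minus the terms with `t ≠ ∅` is an analytic germ whose homogeneous parts are all divisible
by `∏ (-ξ(v i))`. An analytic germ with this property is divisible as a germ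
(`exists_analyticAt_prod_mul_eq`), and the quotient is `μ`. -/

noncomputable section

set_option linter.unusedSectionVars false

namespace EulerMaclaurin

/-! ### Orthogonal projections of lattices along rational subspaces -/

section Lattices

variable {X : Type u} [NormedAddCommGroup X] [InnerProductSpace ℝ X] [FiniteDimensional ℝ X]

theorem ker_perpProj (L : Submodule ℝ X) : LinearMap.ker (perpProj L) = L := by
  ext x
  simp [perpProj]

theorem perpProj_mem (L : Submodule ℝ X) (x : X) : perpProj L x ∈ Lᗮ :=
  Submodule.starProjection_apply_mem _ _

theorem perpProj_eq_zero_iff {L : Submodule ℝ X} {x : X} : perpProj L x = 0 ↔ x ∈ L := by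
  rw [← LinearMap.mem_ker, ker_perpProj]

theorem perpProj_eq_of_mem {L : Submodule ℝ X} {x y : X} (hy : y ∈ Lᗮ) (hxy : x - y ∈ L) :
    perpProj L x = y := by
  refine Submodule.eq_starProjection_of_mem_orthogonal hy ?_
  rwa [Submodule.orthogonal_orthogonal]

theorem sub_perpProj_mem (L : Submodule ℝ X) (x : X) : x - perpProj L x ∈ L := by
  have := Submodule.sub_starProjection_mem_orthogonal (K := Lᗮ) x
  rwa [Submodule.orthogonal_orthogonal] at this

theorem perpProj_of_mem {L : Submodule ℝ X} {x : X} (hx : x ∈ Lᗮ) : perpProj L x = x :=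
  perpProj_eq_of_mem hx (by simp)

theorem perpProj_perpProj {L K : Submodule ℝ X} (h : L ≤ K) (x : X) :
    perpProj K (perpProj L x) = perpProj K x := by
  have : perpProj K (x - perpProj L x) = 0 :=
    perpProj_eq_zero_iff.2 (h (sub_perpProj_mem L x))
  rw [map_sub, sub_eq_zero] at this
  exact this.symm

theorem perpProj_bot : perpProj (⊥ : Submodule ℝ X) = LinearMap.id := by
  ext x
  exact perpProj_of_mem (by simp)

theorem quotLattice_bot (Λ : Submodule ℤ X) : quotLattice Λ ⊥ = Λ := by
  ext x
  simp [quotLattice, perpProj_bot]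

theorem mem_quotLattice {Λ : Submodule ℤ X} {L : Submodule ℝ X} {x : X} :
    x ∈ quotLattice Λ L ↔ ∃ y ∈ Λ, perpProj L y = x := Iff.rfl

theorem quotLattice_le (Λ : Submodule ℤ X) (L : Submodule ℝ X) {x : X} (hx : x ∈ quotLattice Λ L) :
    x ∈ Lᗮ := by
  obtain ⟨y, -, rfl⟩ := hx
  exact perpProj_mem L y

theorem quotLattice_quotLattice (Λ : Submodule ℤ X) {L K : Submodule ℝ X} (h : L ≤ K) :
    quotLattice (quotLattice Λ L) K = quotLattice Λ K := by
  ext x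
  simp only [mem_quotLattice]
  constructor
  · rintro ⟨_, ⟨y, hy, rfl⟩, rfl⟩
    exact ⟨y, hy, (perpProj_perpProj h y).symm⟩
  · rintro ⟨y, hy, rfl⟩
    exact ⟨_, ⟨y, hy, rfl⟩, perpProj_perpProj h y⟩

/-- Some positive multiple of `x` lies in `Λ`. -/
def IsCommensurable (Λ : Submodule ℤ X) (x : X) : Prop := ∃ N : ℕ, 0 < N ∧ N • x ∈ Λ

theorem IsCommensurable.of_mem {Λ : Submodule ℤ X} {x : X} (h : x ∈ Λ) : IsCommensurable Λ x :=
  ⟨1, one_pos, by simpa⟩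

theorem IsCommensurable.sub {Λ : Submodule ℤ X} {x y : X} (hx : IsCommensurable Λ x)
    (hy : IsCommensurable Λ y) : IsCommensurable Λ (x - y) := by
  obtain ⟨N, hN, hx⟩ := hx
  obtain ⟨M, hM, hy⟩ := hy
  refine ⟨N * M, Nat.mul_pos hN hM, ?_⟩
  have : (N * M) • (x - y) = M • (N • x) - N • (M • y) := by
    rw [smul_sub, mul_comm N M, mul_smul, mul_comm M N, mul_smul]
  rw [this]
  exact Λ.sub_mem (Λ.smul_of_tower_mem M hx) (Λ.smul_of_tower_mem N hy)

theorem IsCommensurable.ratCast_smul {Λ : Submodule ℤ X} {x : X} (hx : IsCommensurable Λ x)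
    (q : ℚ) : IsCommensurable Λ ((q : ℝ) • x) := by
  obtain ⟨N, hN, hx⟩ := hx
  refine ⟨N * q.den, Nat.mul_pos hN q.den_pos, ?_⟩
  have : (N * q.den) • ((q : ℝ) • x) = q.num • (N • x) := by
    rw [← Nat.cast_smul_eq_nsmul ℝ, ← Nat.cast_smul_eq_nsmul ℝ N, ← Int.cast_smul_eq_zsmul ℝ,
      smul_smul, smul_smul]
    congr 1
    have : (q.den : ℝ) * (q : ℝ) = q.num := by exact_mod_cast q.den_mul_eq_num
    push_cast
    rw [mul_assoc, this, mul_comm]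
  rw [this]
  exact Λ.smul_mem _ hx

theorem IsCommensurable.inner_rational {Λ : Submodule ℤ X} (hΛ : IsRationalSpace Λ) {x y : X}
    (hx : IsCommensurable Λ x) (hy : IsCommensurable Λ y) : ∃ q : ℚ, inner ℝ x y = (q : ℝ) := by
  obtain ⟨N, hN, hx⟩ := hx
  obtain ⟨M, hM, hy⟩ := hy
  obtain ⟨q, hq⟩ := hΛ.inner_rational _ hx _ hy
  refine ⟨q / (N * M), ?_⟩
  rw [← Nat.cast_smul_eq_nsmul ℝ, ← Nat.cast_smul_eq_nsmul ℝ M, inner_smul_left,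
    inner_smul_right] at hq
  have hN' : (N : ℝ) ≠ 0 := by positivity
  have hM' : (M : ℝ) ≠ 0 := by positivity
  push_cast
  rw [← hq]
  simp only [conj_trivial]
  field_simp

/-- Gram–Schmidt over `ℚ`: the coefficients are quotients of inner products of commensurable
vectors, hence rational. This is where the rationality of the inner product enters. -/
theorem IsCommensurable.exists_orthogonal {Λ : Submodule ℤ X} (hΛ : IsRationalSpace Λ)
    (T : Finset X) (hT : ∀ x ∈ T, IsCommensurable Λ x) {x : X} (hx : IsCommensurable Λ x) :
    ∃ w ∈ Submodule.span ℝ (T : Set X), IsCommensurable Λ w ∧ ∀ y ∈ T, inner ℝ (x - w) y = 0 := by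
  classical
  induction T using Finset.induction_on generalizing x with
  | empty => exact ⟨0, by simp, ⟨1, one_pos, by simp⟩, by simp⟩
  | insert u T hu ih =>
    have hT' : ∀ x ∈ T, IsCommensurable Λ x := fun z hz => hT z (Finset.mem_insert_of_mem hz)
    obtain ⟨a, ha, hac, ha'⟩ := ih hT' hx
    obtain ⟨b, hb, hbc, hb'⟩ := ih hT' (hT u (Finset.mem_insert_self u T))
    have hmono : Submodule.span ℝ (T : Set X) ≤ Submodule.span ℝ ((insert u T : Finset X) : Set X) :=
      Submodule.span_mono (by simp)
    have huc : IsCommensurable Λ (u - b) := (hT u (Finset.mem_insert_self u T)).sub hbc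
    obtain ⟨p, hp⟩ := (hx.sub hac).inner_rational hΛ huc
    obtain ⟨q, hq⟩ := huc.inner_rational hΛ huc
    have hbT : ∀ z : X, (∀ y ∈ T, inner ℝ z y = 0) → inner ℝ z b = 0 := by
      intro z hz
      have : Submodule.span ℝ (T : Set X) ≤ (Submodule.span ℝ {z})ᗮ := by
        rw [Submodule.span_le]
        intro y hy
        rw [SetLike.mem_coe, Submodule.mem_orthogonal_singleton_iff_inner_right]
        exact hz y hy
      exact Submodule.mem_orthogonal_singleton_iff_inner_right.1 (this hb)
    by_cases h0 : u - b = 0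
    · refine ⟨a, hmono ha, hac, fun y hy => ?_⟩
      rcases Finset.mem_insert.1 hy with rfl | hy
      · rw [sub_eq_zero.1 h0]
        exact hbT _ ha'
      · exact ha' y hy
    · have hq0 : (q : ℝ) ≠ 0 := by
        rw [← hq]
        exact inner_self_ne_zero.2 h0
      -- The vector `u - b` is the part of `u` orthogonal to `T`, and `p / q` is the coefficient of
      -- the projection of `x - a` onto it.
      refine ⟨a + ((p / q : ℚ) : ℝ) • (u - b), ?_, ?_, ?_⟩
      · refine Submodule.add_mem _ (hmono ha) (Submodule.smul_mem _ _ (Submodule.sub_mem _ ?_ (hmono hb)))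
        exact Submodule.subset_span (by simp)
      · have := hac.sub (huc.ratCast_smul (-(p / q)))
        simpa using this
      · have hz : ∀ y ∈ T, inner ℝ (x - (a + ((p / q : ℚ) : ℝ) • (u - b))) y = 0 := by
          intro y hy
          rw [← sub_sub, inner_sub_left, ha' y hy, inner_smul_left, hb' y hy]
          simp
        intro y hy
        rcases Finset.mem_insert.1 hy with rfl | hy
        · have h1 : inner ℝ (x - (a + ((p / q : ℚ) : ℝ) • (y - b))) (y - b) = 0 := by
            rw [← sub_sub, inner_sub_left, hp, inner_smul_left, hq]
            push_cast
            simp only [conj_trivial]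
            field_simp
            simp
          rw [inner_sub_right, hbT _ hz, sub_zero] at h1
          exact h1
        · exact hz y hy

theorem IsCommensurable.perpProj {Λ : Submodule ℤ X} (hΛ : IsRationalSpace Λ)
    {L : Submodule ℝ X} (hL : IsRationalSubspace Λ L) {x : X} (hx : IsCommensurable Λ x) :
    IsCommensurable Λ (perpProj L x) := by
  have hfg : (Submodule.span ℝ {x : X | x ∈ Λ ∧ x ∈ L}).FG := IsNoetherian.noetherian _
  obtain ⟨T, hTs, hT⟩ := Submodule.fg_span_iff_fg_span_finset_subset _ |>.1 hfg
  have hL' : Submodule.span ℝ (T : Set X) = L := by rw [← hT]; exact hL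
  obtain ⟨w, hw, hwc, hw'⟩ := IsCommensurable.exists_orthogonal hΛ T
    (fun y hy => .of_mem (hTs hy).1) hx
  have : EulerMaclaurin.perpProj L x = x - w := by
    refine perpProj_eq_of_mem ?_ ?_
    · have : L ≤ (Submodule.span ℝ {x - w})ᗮ := by
        rw [← hL', Submodule.span_le]
        intro y hy
        rw [SetLike.mem_coe, Submodule.mem_orthogonal_singleton_iff_inner_right]
        exact hw' y hy
      rw [Submodule.mem_orthogonal']
      intro y hy
      exact Submodule.mem_orthogonal_singleton_iff_inner_right.1 (this hy)
    · rw [sub_sub_cancel, ← hL']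
      exact hw
  rw [this]
  exact hx.sub hwc

/-- A finite set of generators of `Λ` admits a common denominator for its projections. -/
theorem exists_nsmul_quotLattice_mem {Λ : Submodule ℤ X} (hΛ : IsRationalSpace Λ)
    {L : Submodule ℝ X} (hL : IsRationalSubspace Λ L) :
    ∃ N : ℕ, 0 < N ∧ ∀ x ∈ quotLattice Λ L, N • x ∈ Λ := by
  classical
  have := hΛ.discrete
  have hfg : Λ.FG := Module.Finite.iff_fg.1 inferInstance
  obtain ⟨T, hT⟩ := hfg
  have hTΛ : ∀ x ∈ T, x ∈ Λ := fun x hx => hT ▸ Submodule.subset_span hx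
  choose! N hN hNΛ using fun x (hx : x ∈ T) => (IsCommensurable.of_mem (hTΛ x hx)).perpProj hΛ hL
  refine ⟨∏ x ∈ T, N x, Finset.prod_pos hN, ?_⟩
  rintro _ ⟨y, hy, rfl⟩
  rw [SetLike.mem_coe, ← hT] at hy
  induction hy using Submodule.span_induction with
  | mem x hx =>
    rw [← Finset.prod_erase_mul T N hx, mul_smul]
    exact Λ.smul_of_tower_mem _ (hNΛ x hx)
  | zero => simp
  | add x y _ _ hx hy =>
    rw [map_add, smul_add]
    exact Λ.add_mem hx hy
  | smul a x _ hx =>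
    rw [map_smul, smul_comm]
    exact Λ.smul_mem a hx

/-- Multiplication by the common denominator embeds the projected lattice continuously into the
discrete group `Λ`. -/
theorem discreteTopology_quotLattice {Λ : Submodule ℤ X} (hΛ : IsRationalSpace Λ)
    {L : Submodule ℝ X} (hL : IsRationalSubspace Λ L) : DiscreteTopology (quotLattice Λ L) := by
  obtain ⟨N, hN, hNΛ⟩ := exists_nsmul_quotLattice_mem hΛ hL
  have := hΛ.discrete
  refine DiscreteTopology.of_continuous_injective
    (f := fun x : quotLattice Λ L => (⟨N • (x : X), hNΛ x x.2⟩ : Λ)) (by fun_prop) ?_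
  intro x y hxy
  have : N • (x : X) = N • (y : X) := congrArg Subtype.val hxy
  rw [← Nat.cast_smul_eq_nsmul ℝ, ← Nat.cast_smul_eq_nsmul ℝ] at this
  exact Subtype.ext (smul_right_injective X (Nat.cast_ne_zero.2 hN.ne' : (N : ℝ) ≠ 0) this)

theorem mem_latticeIn {M : Submodule ℤ X} {K : Submodule ℝ X} {x : K} :
    x ∈ latticeIn M K ↔ (x : X) ∈ M := Iff.rfl

theorem isRationalSpace_orthogonal {Λ : Submodule ℤ X} (hΛ : IsRationalSpace Λ)
    {L : Submodule ℝ X} (hL : IsRationalSubspace Λ L) :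
    IsRationalSpace (latticeIn (quotLattice Λ L) Lᗮ) where
  discrete := by
    have := discreteTopology_quotLattice hΛ hL
    refine DiscreteTopology.of_continuous_injective
      (f := fun x : latticeIn (quotLattice Λ L) Lᗮ => (⟨((x : Lᗮ) : X), x.2⟩ : quotLattice Λ L))
      (by fun_prop) ?_
    intro x y hxy
    have : ((x : Lᗮ) : X) = ((y : Lᗮ) : X) := congrArg (fun z : quotLattice Λ L => (z : X)) hxy
    exact Subtype.ext (Subtype.ext this)
  span_eq_top := by
    let P : X →ₗ[ℝ] Lᗮ := (perpProj L).codRestrict Lᗮ (perpProj_mem L)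
    have hP : Function.Surjective P := fun y => ⟨y, Subtype.ext (perpProj_of_mem y.2)⟩
    rw [eq_top_iff, ← LinearMap.range_eq_top.2 hP, LinearMap.range_eq_map, ← hΛ.span_eq_top,
      Submodule.map_span]
    refine Submodule.span_mono ?_
    rintro _ ⟨y, hy, rfl⟩
    exact ⟨y, hy, rfl⟩
  inner_rational := by
    rintro x ⟨a, ha, hax⟩ y ⟨b, hb, hby⟩
    have := ((IsCommensurable.of_mem ha).perpProj hΛ hL).inner_rational hΛ
      ((IsCommensurable.of_mem hb).perpProj hΛ hL)
    rw [Submodule.coe_inner]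
    convert this using 3
    congr 1
    · exact hax.symm
    · exact hby.symm

end Lattices

/-! ### Unimodular cones, their faces and their transverse cones in a lattice basis -/

section LatticeBases

variable {X : Type u} [NormedAddCommGroup X] [InnerProductSpace ℝ X] [FiniteDimensional ℝ X]
  {ι : Type*} [Fintype ι]

/-- The family `v` is linearly independent over `ℝ` and generates the subgroup `M`. -/
structure IsLatticeBasis (M : Submodule ℤ X) (v : ι → X) : Prop where
  linearIndependent : LinearIndependent ℝ v
  span_eq : Submodule.span ℤ (Set.range v) = M

/-- The cone generated by the vectors `v i`, `i ∈ s`. -/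
def cone (v : ι → X) (s : Finset ι) : PointedCone ℝ X := PointedCone.hull ℝ (v '' (s : Set ι))

theorem IsLatticeBasis.mem {M : Submodule ℤ X} {v : ι → X} (h : IsLatticeBasis M v) (i : ι) :
    v i ∈ M := h.span_eq ▸ Submodule.subset_span ⟨i, rfl⟩

theorem mem_span_range_int_iff {v : ι → X} {x : X} :
    x ∈ Submodule.span ℤ (Set.range v) ↔ ∃ c : ι → ℤ, ∑ i, (c i : ℝ) • v i = x := by
  rw [Submodule.mem_span_range_iff_exists_fun]
  simp only [Int.cast_smul_eq_zsmul]

/-- For a discrete subgroup, the rank over `ℤ` equals the dimension of the real span. -/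
theorem linearIndependent_of_basis {M : Submodule ℤ X} [DiscreteTopology M]
    (b : Module.Basis ι ℤ M) : LinearIndependent ℝ (fun i => (b i : X)) := by
  have hspan : Submodule.span ℤ (Set.range fun i => (b i : X)) = M := by
    have : (Set.range fun i => (b i : X)) = M.subtype '' Set.range b := by
      rw [← Set.range_comp]; rfl
    rw [this, ← Submodule.map_span, b.span_eq, Submodule.map_top, Submodule.range_subtype]
  rw [linearIndependent_iff_card_eq_finrank_span,
    Real.finrank_eq_int_finrank_of_discrete, Set.finrank, hspan, Module.finrank_eq_card_basis b]
  rw [hspan]; infer_instance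

theorem IsUnimodular.exists_isLatticeBasis {M : Submodule ℤ X} [DiscreteTopology M]
    {C : PointedCone ℝ X} (h : IsUnimodular M C) :
    ∃ (k : ℕ) (v : Fin k → X) (s : Finset (Fin k)), IsLatticeBasis M v ∧ C = cone v s := by
  classical
  obtain ⟨k, b, s, rfl⟩ := h
  refine ⟨k, fun i => (b i : X), s.toFinset, ⟨linearIndependent_of_basis b, ?_⟩, by simp [cone]⟩
  have : (Set.range fun i => (b i : X)) = M.subtype '' Set.range b := by
    rw [← Set.range_comp]; rfl
  rw [this, ← Submodule.map_span, b.span_eq, Submodule.map_top, Submodule.range_subtype]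

theorem IsLatticeBasis.isUnimodular {M : Submodule ℤ X} {v : ι → X} (h : IsLatticeBasis M v)
    (s : Finset ι) : IsUnimodular M (cone v s) := by
  classical
  obtain ⟨hv, rfl⟩ := h
  have hv' : LinearIndependent ℤ v := hv.restrict_scalars' ℤ
  let e := Fintype.equivFin ι
  let b := (Module.Basis.span hv').reindex e
  refine ⟨Fintype.card ι, b, e '' s, ?_⟩
  have : (fun i => ((b i : Submodule.span ℤ (Set.range v)) : X)) = v ∘ e.symm := by
    ext i
    simp [b, Module.Basis.span_apply]
  rw [this, cone, ← Set.image_comp, Function.comp_assoc]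
  simp

theorem mem_cone {v : ι → X} {s : Finset ι} {x : X} :
    x ∈ cone v s ↔ ∃ c : ι → ℝ, (∀ i, 0 ≤ c i) ∧ (∀ i, i ∉ s → c i = 0) ∧ ∑ i, c i • v i = x := by
  classical
  constructor
  · intro hx
    induction hx using Submodule.span_induction with
    | mem x hx =>
      obtain ⟨i, hi, rfl⟩ := hx
      refine ⟨Pi.single i 1, fun j => ?_, fun j hj => ?_, by simp [Pi.single_apply, ite_smul]⟩
      · by_cases h : j = i <;> simp [h]
      · have : j ≠ i := fun h => hj (h ▸ hi)
        simp [this]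
    | zero => exact ⟨0, by simp, by simp, by simp⟩
    | add x y _ _ hx hy =>
      obtain ⟨c, hc, hc', rfl⟩ := hx
      obtain ⟨d, hd, hd', rfl⟩ := hy
      refine ⟨c + d, fun i => add_nonneg (hc i) (hd i), fun i hi => ?_, ?_⟩
      · simp [hc' i hi, hd' i hi]
      · simp [add_smul, Finset.sum_add_distrib]
    | smul a x _ hx =>
      obtain ⟨c, hc, hc', rfl⟩ := hx
      refine ⟨(a : ℝ) • c, fun i => mul_nonneg a.2 (hc i), fun i hi => by simp [hc' i hi], ?_⟩
      simp only [Pi.smul_apply, smul_assoc, ← Finset.smul_sum]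
      rfl
  · rintro ⟨c, hc, hc', rfl⟩
    refine Submodule.sum_mem _ fun i _ => ?_
    by_cases hi : i ∈ s
    · exact Submodule.smul_mem _ (⟨c i, hc i⟩ : {c : ℝ // 0 ≤ c})
        (Submodule.subset_span ⟨i, hi, rfl⟩)
    · rw [hc' i hi, zero_smul]
      exact Submodule.zero_mem _

theorem mem_cone_of_mem {v : ι → X} {s : Finset ι} {i : ι} (hi : i ∈ s) : v i ∈ cone v s :=
  Submodule.subset_span ⟨i, hi, rfl⟩

theorem cone_mono (v : ι → X) {s t : Finset ι} (h : t ⊆ s) : cone v t ≤ cone v s :=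
  Submodule.span_mono (Set.image_mono (by exact_mod_cast h))

theorem cone_empty (v : ι → X) : cone v ∅ = ⊥ := by simp [cone]

theorem sum_smul_injective {v : ι → X} (hv : LinearIndependent ℝ v) {c d : ι → ℝ}
    (h : ∑ i, c i • v i = ∑ i, d i • v i) : c = d :=
  hv.fintypeLinearCombination_injective (by simpa [Fintype.linearCombination_apply] using h)

theorem sum_smul_mem_cone {v : ι → X} (hv : LinearIndependent ℝ v) {s : Finset ι} {c : ι → ℝ} :
    ∑ i, c i • v i ∈ cone v s ↔ (∀ i, 0 ≤ c i) ∧ ∀ i, i ∉ s → c i = 0 := by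
  rw [mem_cone]
  constructor
  · rintro ⟨d, hd, hd', h⟩
    obtain rfl := sum_smul_injective hv h
    exact ⟨hd, hd'⟩
  · rintro ⟨h, h'⟩
    exact ⟨c, h, h', rfl⟩

theorem mem_cone_iff_mem {v : ι → X} (hv : LinearIndependent ℝ v) {s : Finset ι} {i : ι} :
    v i ∈ cone v s ↔ i ∈ s := by
  classical
  refine ⟨fun h => ?_, mem_cone_of_mem⟩
  have : v i = ∑ j, (Pi.single i 1 : ι → ℝ) j • v j := by simp [Pi.single_apply, ite_smul]
  rw [this, sum_smul_mem_cone hv] at h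
  by_contra hi
  simpa using h.2 i hi

theorem cone_injective {v : ι → X} (hv : LinearIndependent ℝ v) : Function.Injective (cone v) := by
  intro s t h
  ext i
  rw [← mem_cone_iff_mem hv, h, mem_cone_iff_mem hv]

/-- A generator that occurs with positive coefficient in a point of a face lies in that face, so a
face is generated by the generators it contains. Conversely, coefficients are unique and
nonnegative, so a vanishing coefficient of a sum vanishes in each summand. -/
theorem isFaceOf_cone_iff {v : ι → X} (hv : LinearIndependent ℝ v) {s : Finset ι}
    {F : PointedCone ℝ X} : F.IsFaceOf (cone v s) ↔ ∃ t ⊆ s, F = cone v t := by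
  classical
  constructor
  · intro hF
    refine ⟨s.filter (fun i => v i ∈ F), Finset.filter_subset _ _, le_antisymm ?_ ?_⟩
    · intro x hx
      obtain ⟨c, hc, hc', rfl⟩ := mem_cone.1 (hF.le hx)
      rw [sum_smul_mem_cone hv]
      refine ⟨hc, fun i hi => ?_⟩
      by_contra h0
      have his : i ∈ s := by
        by_contra his
        exact h0 (hc' i his)
      have hpos : 0 < c i := lt_of_le_of_ne (hc i) (Ne.symm h0)
      refine hi (Finset.mem_filter.2 ⟨his, ?_⟩)
      rw [← Finset.add_sum_erase _ _ (Finset.mem_univ i)] at hx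
      refine hF.mem_of_smul_add_mem (mem_cone_of_mem his) ?_ hpos hx
      refine Submodule.sum_mem _ fun j _ => ?_
      by_cases hj : j ∈ s
      · exact Submodule.smul_mem _ (⟨c j, hc j⟩ : {c : ℝ // 0 ≤ c}) (mem_cone_of_mem hj)
      · rw [hc' j hj, zero_smul]
        exact Submodule.zero_mem _
    · refine Submodule.span_le.2 ?_
      rintro _ ⟨i, hi, rfl⟩
      exact (Finset.mem_filter.1 hi).2
  · rintro ⟨t, ht, rfl⟩
    refine ⟨cone_mono v ht, ?_⟩
    intro x y a hx hy ha hxy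
    obtain ⟨c, hc, hc', rfl⟩ := mem_cone.1 hx
    obtain ⟨d, hd, hd', rfl⟩ := mem_cone.1 hy
    rw [Finset.smul_sum, ← Finset.sum_add_distrib] at hxy
    simp_rw [smul_smul, ← add_smul] at hxy
    rw [sum_smul_mem_cone hv] at hxy ⊢
    refine ⟨hc, fun i hi => ?_⟩
    have h1 := hxy.2 i hi
    have h2 := mul_nonneg ha.le (hc i)
    have h3 := hd i
    have : a * c i = 0 := by linarith
    exact (mul_eq_zero.1 this).resolve_left ha.ne'

theorem coneSpan_cone (v : ι → X) (s : Finset ι) :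
    coneSpan (cone v s) = Submodule.span ℝ (v '' (s : Set ι)) := by
  refine le_antisymm (Submodule.span_le.2 fun x hx => ?_) (Submodule.span_mono Submodule.subset_span)
  obtain ⟨c, hc, hc', rfl⟩ := mem_cone.1 hx
  refine Submodule.sum_mem _ fun i _ => ?_
  by_cases hi : i ∈ s
  · exact Submodule.smul_mem _ _ (Submodule.subset_span ⟨i, hi, rfl⟩)
  · rw [hc' i hi, zero_smul]
    exact Submodule.zero_mem _

theorem coneDim_cone {v : ι → X} (hv : LinearIndependent ℝ v) (s : Finset ι) :
    coneDim (cone v s) = s.card := by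
  have : LinearIndependent ℝ (fun i : s => v i) := hv.comp _ Subtype.val_injective
  have h := finrank_span_eq_card this
  rw [coneDim, coneSpan_cone, Set.image_eq_range]
  simpa using h

theorem mem_span_image_iff {v : ι → X} (hv : LinearIndependent ℝ v) {t : Finset ι} {c : ι → ℝ} :
    ∑ i, c i • v i ∈ Submodule.span ℝ (v '' (t : Set ι)) ↔ ∀ i, i ∉ t → c i = 0 := by
  classical
  constructor
  · intro h
    rw [Set.image_eq_range, Submodule.mem_span_range_iff_exists_fun] at h
    obtain ⟨d, hd⟩ := h
    have h2 : ∑ i, (if h : i ∈ t then d ⟨i, h⟩ else 0) • v i = ∑ i, c i • v i := by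
      rw [← hd]
      simp_rw [dite_smul, zero_smul]
      rw [Finset.sum_dite, Finset.sum_const_zero, add_zero]
      refine Finset.sum_bij (fun x _ => ⟨x.1, by simpa using x.2⟩) (by simp) ?_ ?_ ?_
      · rintro ⟨a, _⟩ _ ⟨b, _⟩ _ h
        simpa using h
      · rintro ⟨b, hb⟩ _
        exact ⟨⟨b, by simpa using hb⟩, by simp, rfl⟩
      · simp
    have h3 := sum_smul_injective hv h2
    intro i hi
    rw [← h3]
    simp [hi]
  · intro h
    refine Submodule.sum_mem _ fun i _ => ?_
    by_cases hi : i ∈ t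
    · exact Submodule.smul_mem _ _ (Submodule.subset_span ⟨i, hi, rfl⟩)
    · rw [h i hi, zero_smul]
      exact Submodule.zero_mem _

theorem cone_map {Y : Type*} [NormedAddCommGroup Y] [InnerProductSpace ℝ Y] (f : X →ₗ[ℝ] Y)
    (v : ι → X) (s : Finset ι) : (cone v s).map f = cone (f ∘ v) s := by
  rw [cone, cone, Set.image_comp]
  exact Submodule.map_span _ _

theorem cone_eq_cone_subtype [DecidableEq ι] {v : ι → X} (s t : Finset ι) (h : ∀ i ∈ t, v i = 0) :
    cone v s = cone (fun i : {i // i ∉ t} => v i) (s.subtype (· ∉ t)) := by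
  refine le_antisymm (Submodule.span_le.2 ?_) (Submodule.span_le.2 ?_)
  · rintro _ ⟨i, hi, rfl⟩
    by_cases hit : i ∈ t
    · rw [h i hit]
      exact Submodule.zero_mem _
    · exact Submodule.subset_span ⟨⟨i, hit⟩, by simpa using hi, rfl⟩
  · rintro _ ⟨i, hi, rfl⟩
    exact Submodule.subset_span ⟨i, by simpa using hi, rfl⟩

theorem finsum_faces {G : Type*} [AddCommMonoid G] {v : ι → X} (hv : LinearIndependent ℝ v)
    (s : Finset ι) (p : PointedCone ℝ X → Prop) [DecidablePred fun t => p (cone v t)]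
    (g : PointedCone ℝ X → G) :
    ∑ᶠ (F : PointedCone ℝ X) (_ : F.IsFaceOf (cone v s) ∧ p F), g F =
      ∑ t ∈ s.powerset.filter (fun t => p (cone v t)), g (cone v t) := by
  have hset : {F : PointedCone ℝ X | F.IsFaceOf (cone v s) ∧ p F} =
      cone v '' ((s.powerset.filter (fun t => p (cone v t)) : Finset (Finset ι)) : Set (Finset ι)) := by
    ext F
    simp only [Set.mem_ofPred_eq, isFaceOf_cone_iff hv, Set.mem_image, Finset.coe_filter,
      Finset.mem_powerset]
    constructor
    · rintro ⟨⟨t, ht, rfl⟩, hp⟩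
      exact ⟨t, ⟨ht, hp⟩, rfl⟩
    · rintro ⟨t, ⟨ht, hp⟩, rfl⟩
      exact ⟨⟨t, ht, rfl⟩, hp⟩
  have : ∑ᶠ (F : PointedCone ℝ X) (_ : F.IsFaceOf (cone v s) ∧ p F), g F =
      ∑ᶠ F ∈ {F : PointedCone ℝ X | F.IsFaceOf (cone v s) ∧ p F}, g F := rfl
  rw [this, hset, finsum_mem_image (cone_injective hv).injOn, finsum_mem_coe_finset]

/-- A relation between the projected vectors is a combination of the `v i`, `i ∉ t`, lying in `L ⊔
coneSpan (cone v t)`. All `v i` lie in `Lᗮ`, so its component in `L` is zero and it lies in the span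
of the `v i`, `i ∈ t`; independence of `v` then makes it trivial. -/
theorem IsLatticeBasis.quot [DecidableEq ι] {Λ : Submodule ℤ X} {L : Submodule ℝ X} {v : ι → X}
    (h : IsLatticeBasis (quotLattice Λ L) v) (t : Finset ι) :
    IsLatticeBasis (quotLattice Λ (L ⊔ coneSpan (cone v t)))
      (fun i : {i // i ∉ t} => perpProj (L ⊔ coneSpan (cone v t)) (v i)) := by
  set K := L ⊔ coneSpan (cone v t) with hK
  have hmem : ∀ i ∈ t, v i ∈ K := fun i hi =>
    Submodule.mem_sup_right (by rw [coneSpan_cone]; exact Submodule.subset_span ⟨i, hi, rfl⟩)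
  have hvL : ∀ i, v i ∈ Lᗮ := fun i => quotLattice_le Λ L (h.mem i)
  constructor
  · rw [Fintype.linearIndependent_iff]
    intro c hc i
    have h1 : ∑ j, (if hj : j ∉ t then c ⟨j, hj⟩ else 0) • v j ∈ K := by
      rw [← perpProj_eq_zero_iff, map_sum, ← hc]
      simp_rw [dite_smul, zero_smul]
      simp only [apply_dite (perpProj K), map_zero, map_smul]
      rw [Finset.sum_dite, Finset.sum_const_zero, add_zero]
      refine Finset.sum_bij (fun x _ => ⟨x.1, (Finset.mem_filter.1 x.2).2⟩) (by simp) ?_ ?_ ?_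
      · rintro ⟨a, _⟩ _ ⟨b, _⟩ _ h
        simpa using h
      · rintro ⟨b, hb⟩ _
        exact ⟨⟨b, by simpa using hb⟩, by simp, rfl⟩
      · simp
    have h2 : ∑ j, (if hj : j ∉ t then c ⟨j, hj⟩ else 0) • v j ∈ Lᗮ :=
      Submodule.sum_mem _ fun j _ => Submodule.smul_mem _ _ (hvL j)
    obtain ⟨l, hl, w, hw, hlw⟩ := Submodule.mem_sup.1 h1
    have hw' : w ∈ Lᗮ := by
      rw [coneSpan_cone] at hw
      refine Submodule.span_le.2 ?_ hw
      rintro _ ⟨j, -, rfl⟩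
      exact hvL j
    have hl0 : l = 0 := by
      have : l ∈ Lᗮ := by
        rw [← hlw] at h2
        simpa using Submodule.sub_mem _ h2 hw'
      have := (Submodule.mem_orthogonal _ _).1 this l hl
      exact inner_self_eq_zero.1 this
    rw [hl0, zero_add] at hlw
    rw [hlw, coneSpan_cone, mem_span_image_iff h.linearIndependent] at hw
    have := hw i i.2
    simpa [i.2] using this
  · rw [← quotLattice_quotLattice Λ (le_sup_left : L ≤ K), ← h.span_eq, quotLattice,
      Submodule.map_span, ← Set.range_comp]
    refine le_antisymm (Submodule.span_mono ?_) (Submodule.span_le.2 ?_)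
    · rintro _ ⟨i, rfl⟩
      exact ⟨i, rfl⟩
    · rintro _ ⟨i, rfl⟩
      by_cases hi : i ∈ t
      · have : perpProj K (v i) = 0 := perpProj_eq_zero_iff.2 (hmem i hi)
        change perpProj K (v i) ∈ Submodule.span ℤ _
        rw [this]
        exact Submodule.zero_mem _
      · exact Submodule.subset_span ⟨⟨i, hi⟩, rfl⟩

theorem cone_map_perpProj [DecidableEq ι] (L : Submodule ℝ X) (v : ι → X) (s t : Finset ι) :
    (cone v s).map (perpProj (L ⊔ coneSpan (cone v t))) =
      cone (fun i : {i // i ∉ t} => perpProj (L ⊔ coneSpan (cone v t)) (v i))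
        (s.subtype (· ∉ t)) := by
  rw [cone_map, cone_eq_cone_subtype s t]
  · rfl
  · intro i hi
    exact perpProj_eq_zero_iff.2 (Submodule.mem_sup_right
      (by rw [coneSpan_cone]; exact Submodule.subset_span ⟨i, hi, rfl⟩))

theorem card_subtype_notMem [DecidableEq ι] {s t : Finset ι} :
    (s.subtype (· ∉ t)).card = (s \ t).card := by
  rw [Finset.card_subtype, Finset.sdiff_eq_filter]

/-- Each `v i` is the projection of some `y ∈ Λ`, and `y - v i` lies in `L`, which is already
spanned by lattice vectors. -/
theorem IsRationalSubspace.sup_coneSpan {Λ : Submodule ℤ X} {L : Submodule ℝ X}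
    (hL : IsRationalSubspace Λ L) {v : ι → X} (hv : ∀ i, v i ∈ quotLattice Λ L) (t : Finset ι) :
    IsRationalSubspace Λ (L ⊔ coneSpan (cone v t)) := by
  refine le_antisymm (Submodule.span_le.2 fun x hx => hx.2) ?_
  have hle : L ≤ Submodule.span ℝ {x : X | x ∈ Λ ∧ x ∈ L ⊔ coneSpan (cone v t)} := by
    conv_lhs => rw [← hL]
    exact Submodule.span_mono fun x hx => ⟨hx.1, Submodule.mem_sup_left hx.2⟩
  refine sup_le hle ?_
  rw [coneSpan_cone, Submodule.span_le]
  rintro _ ⟨i, hi, rfl⟩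
  obtain ⟨y, hy, hyv⟩ := hv i
  have h1 : y - v i ∈ L := by
    rw [← hyv]
    exact sub_perpProj_mem L y
  have h2 : v i ∈ coneSpan (cone v t) := by
    rw [coneSpan_cone]; exact Submodule.subset_span ⟨i, hi, rfl⟩
  have h3 : y ∈ L ⊔ coneSpan (cone v t) := by
    rw [← sub_add_cancel y (v i)]
    exact Submodule.add_mem_sup h1 h2
  have h4 := Submodule.sub_mem _ (Submodule.subset_span (R := ℝ)
    (show y ∈ {x : X | x ∈ Λ ∧ x ∈ L ⊔ coneSpan (cone v t)} from ⟨hy, h3⟩)) (hle h1)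
  rw [sub_sub_cancel, coneSpan_cone] at h4
  exact h4

theorem isRationalSubspace_bot (Λ : Submodule ℤ X) : IsRationalSubspace Λ ⊥ := by
  refine le_antisymm (Submodule.span_le.2 fun x hx => hx.2) bot_le

theorem coneIn_cone {K : Submodule ℝ X} (v : ι → K) (s : Finset ι) :
    coneIn (cone (fun i => (v i : X)) s) K = cone v s := by
  ext x
  have : x ∈ coneIn (cone (fun i => (v i : X)) s) K ↔ (x : X) ∈ cone (fun i => (v i : X)) s := Iff.rfl
  rw [this, mem_cone, mem_cone]
  refine exists_congr fun c => and_congr_right fun _ => and_congr_right fun _ => ?_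
  rw [← Subtype.coe_inj]
  simp

/-- The restriction of a lattice basis of a subgroup of `K` to the subspace `K`. -/
theorem IsLatticeBasis.latticeIn {M : Submodule ℤ X} {K : Submodule ℝ X} {v : ι → K}
    (h : IsLatticeBasis M (fun i => (v i : X))) : IsLatticeBasis (latticeIn M K) v where
  linearIndependent := LinearIndependent.of_comp K.subtype h.linearIndependent
  span_eq := by
    ext x
    rw [mem_latticeIn, ← h.span_eq, mem_span_range_int_iff, mem_span_range_int_iff]
    refine exists_congr fun c => ?_
    rw [← Subtype.coe_inj]
    simp

end LatticeBases

/-! ### Exponential sums over the lattice points of a unimodular cone -/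

section LatticeSums

theorem hasSum_pi_fin_geometric (k : ℕ) (r : Fin k → ℝ) (h0 : ∀ i, 0 ≤ r i) (h1 : ∀ i, r i < 1) :
    HasSum (fun n : Fin k → ℕ => ∏ i, r i ^ n i) (∏ i, (1 - r i)⁻¹) := by
  induction k with
  | zero => simp
  | succ k ih =>
    have h := ih (fun i => r i.succ) (fun i => h0 _) (fun i => h1 _)
    have hg := hasSum_geometric_of_lt_one (h0 0) (h1 0)
    have hp : (0 : ℕ → ℝ) ≤ fun n => r 0 ^ n := fun n => pow_nonneg (h0 0) n
    have hq : (0 : (Fin k → ℕ) → ℝ) ≤ fun n => ∏ i, r i.succ ^ n i :=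
      fun n => Finset.prod_nonneg fun i _ => pow_nonneg (h0 _) _
    have hs := Summable.mul_of_nonneg hg.summable h.summable hp hq
    have hm := HasSum.mul hg h hs
    rw [← (Fin.consEquiv fun _ : Fin (k + 1) => ℕ).hasSum_iff, Fin.prod_univ_succ]
    refine hm.congr_fun ?_
    intro x
    simp [Fin.prod_univ_succ, Fin.consEquiv]

theorem hasSum_pi_geometric {κ : Type*} [Fintype κ] (r : κ → ℝ) (h0 : ∀ i, 0 ≤ r i)
    (h1 : ∀ i, r i < 1) :
    HasSum (fun n : κ → ℕ => ∏ i, r i ^ n i) (∏ i, (1 - r i)⁻¹) := by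
  let e := Fintype.equivFin κ
  have h := hasSum_pi_fin_geometric _ (fun i => r (e.symm i)) (fun i => h0 _) (fun i => h1 _)
  rw [← (Equiv.arrowCongr e (Equiv.refl ℕ)).hasSum_iff] at h
  convert h using 1
  · ext n
    simp only [Function.comp_apply, Equiv.arrowCongr_apply, Equiv.coe_refl, id]
    exact (e.symm.prod_comp (fun i => r i ^ n i)).symm
  · exact (e.symm.prod_comp (fun i => (1 - r i)⁻¹)).symm

variable {X : Type u} [NormedAddCommGroup X] [InnerProductSpace ℝ X] [FiniteDimensional ℝ X]
  {ι : Type*} [Fintype ι]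

/-- The lattice points of a unimodular cone are the combinations of its generators with
coefficients in `ℕ`. -/
theorem exists_equiv_latticePoints {M : Submodule ℤ X} {v : ι → X} (h : IsLatticeBasis M v)
    (s : Finset ι) :
    ∃ e : (s → ℕ) ≃ {γ : X // γ ∈ M ∧ γ ∈ cone v s}, ∀ n, (e n : X) = ∑ i, (n i : ℝ) • v i := by
  classical
  have hmem : ∀ n : s → ℕ, ∑ i, (n i : ℝ) • v i ∈ M ∧ ∑ i, (n i : ℝ) • v i ∈ cone v s := by
    refine fun n => ⟨Submodule.sum_mem _ fun i _ => ?_, Submodule.sum_mem _ fun i _ => ?_⟩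
    · rw [Nat.cast_smul_eq_nsmul]
      exact M.smul_of_tower_mem _ (h.mem i)
    · exact Submodule.smul_mem _ (⟨n i, Nat.cast_nonneg _⟩ : {c : ℝ // 0 ≤ c})
        (mem_cone_of_mem i.2)
  refine ⟨Equiv.ofBijective (fun n => ⟨_, hmem n⟩) ⟨?_, ?_⟩, fun n => rfl⟩
  · intro n m hnm
    have h1 : ∑ i, (n i : ℝ) • v i = ∑ i, (m i : ℝ) • v i := congrArg Subtype.val hnm
    have h2 : LinearIndependent ℝ (fun i : s => v i) :=
      h.linearIndependent.comp _ Subtype.val_injective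
    have h3 := sum_smul_injective h2 h1
    ext i
    exact_mod_cast congrFun h3 i
  · rintro ⟨γ, hγM, hγC⟩
    rw [← h.span_eq, mem_span_range_int_iff] at hγM
    obtain ⟨c, rfl⟩ := hγM
    rw [sum_smul_mem_cone h.linearIndependent] at hγC
    refine ⟨fun i => (c i).toNat, Subtype.ext ?_⟩
    have h1 : ∑ i, (c i : ℝ) • v i = ∑ i ∈ s, (c i : ℝ) • v i :=
      (Finset.sum_subset (Finset.subset_univ s) fun i _ hi => by rw [hγC.2 i hi, zero_smul]).symm
    simp only
    rw [h1, ← Finset.sum_coe_sort s]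
    refine Finset.sum_congr rfl fun i _ => ?_
    have : ((c i).toNat : ℤ) = c i := Int.toNat_of_nonneg (by exact_mod_cast hγC.1 i)
    congr 1
    exact_mod_cast this

theorem hasSum_exp_latticePoints {M : Submodule ℤ X} {v : ι → X} (h : IsLatticeBasis M v)
    (s : Finset ι) (ξ : StrongDual ℝ X) (hξ : ∀ i ∈ s, ξ (v i) < 0) :
    HasSum (fun γ : {γ : X // γ ∈ M ∧ γ ∈ cone v s} => Real.exp (ξ (γ : X)))
      (∏ i ∈ s, (1 - Real.exp (ξ (v i)))⁻¹) := by
  obtain ⟨e, he⟩ := exists_equiv_latticePoints h s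
  rw [← e.hasSum_iff, ← Finset.prod_coe_sort]
  convert hasSum_pi_geometric (fun i : s => Real.exp (ξ (v i))) (fun i => (Real.exp_pos _).le)
    (fun i => Real.exp_lt_one_iff.2 (hξ i i.2)) using 2 with n
  simp only [Function.comp_apply, he, map_sum, map_smul, smul_eq_mul, Real.exp_sum, Real.exp_nat_mul]

end LatticeSums

/-! ### Normalized Lebesgue measure and exponential integrals over faces -/

section ConeIntegrals

variable {X : Type u} [NormedAddCommGroup X] [InnerProductSpace ℝ X] [FiniteDimensional ℝ X]
  {κ : Type*} [Fintype κ]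

/-- Both sides are Haar measures that give the parallelepiped of `b` mass `1`, hence both are
`b.addHaar`. -/
theorem map_volume_eq_normalized [MeasurableSpace X] [BorelSpace X] (b : Module.Basis κ ℝ X) :
    (ENNReal.ofReal (ZLattice.covolume (Submodule.span ℤ (Set.range b)) volume))⁻¹ •
      (volume : Measure X) =
    Measure.map b.equivFunL.symm (volume : Measure (κ → ℝ)) := by
  have hpos := ZLattice.covolume_pos (Submodule.span ℤ (Set.range b)) (volume : Measure X)
  have h1 : (ENNReal.ofReal (ZLattice.covolume (Submodule.span ℤ (Set.range b)) volume))⁻¹ ≠ 0 :=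
    ENNReal.inv_ne_zero.2 ENNReal.ofReal_ne_top
  have h2 : (ENNReal.ofReal (ZLattice.covolume (Submodule.span ℤ (Set.range b)) volume))⁻¹ ≠ ⊤ :=
    ENNReal.inv_ne_top.2 (ENNReal.ofReal_pos.2 hpos).ne'
  have := Measure.IsAddHaarMeasure.smul (volume : Measure X) h1 h2
  have := ContinuousLinearEquiv.isAddHaarMeasure_map b.equivFunL.symm (volume : Measure (κ → ℝ))
  have : SigmaFinite ((ENNReal.ofReal (ZLattice.covolume (Submodule.span ℤ (Set.range b))
    volume))⁻¹ • (volume : Measure X)) := inferInstance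
  refine ((b.addHaar_eq_iff _).2 ?_).symm.trans ((b.addHaar_eq_iff _).2 ?_)
  rotate_left
  · rw [Measure.map_apply b.equivFunL.symm.continuous.measurable
      b.parallelepiped.isCompact.measurableSet]
    have : b.equivFunL.symm ⁻¹' (b.parallelepiped : Set X) = Set.Icc 0 1 := by
      ext x
      rw [Module.Basis.coe_parallelepiped, parallelepiped_basis_eq]
      have hx : ∀ i, b.repr (b.equivFunL.symm x) i = x i := fun i =>
        congrFun (b.equivFun.apply_symm_apply x) i
      simp [Set.mem_Icc, Pi.le_def, hx, forall_and]
    rw [this, Real.volume_Icc_pi]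
    simp
  · have hF := ZSpan.isAddFundamentalDomain b (volume : Measure X)
    have h3 := ZLattice.covolume_eq_measure_fundamentalDomain _ volume hF
    have h4 := measure_congr (ZSpan.fundamentalDomain_ae_parallelepiped b (volume : Measure X))
    have h5 : (volume : Measure X) (b.parallelepiped : Set X) ≠ ⊤ :=
      b.parallelepiped.isCompact.measure_lt_top.ne
    rw [Module.Basis.coe_parallelepiped] at h5 ⊢
    rw [Measure.smul_apply, h3, Measure.real, h4, ENNReal.ofReal_toReal h5, smul_eq_mul,
      ENNReal.inv_mul_cancel _ h5]
    intro h0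
    rw [Measure.real, h4, h0] at h3
    rw [h3] at hpos
    simp at hpos

theorem latticeIntegral_cone_univ {M : Submodule ℤ X} (b : Module.Basis κ ℝ X)
    (hM : Submodule.span ℤ (Set.range b) = M) {G : Type*} [NormedAddCommGroup G] [NormedSpace ℝ G]
    (g : X → G) :
    latticeIntegral M (cone b Finset.univ : Set X) g =
      ∫ x in Set.pi Set.univ (fun _ : κ => Set.Ici (0 : ℝ)), g (∑ i, x i • b i) := by
  subst hM
  let mX : MeasurableSpace X := borel X
  have : BorelSpace X := ⟨rfl⟩
  have hpre : b.equivFunL.symm ⁻¹' (cone b Finset.univ : Set X) =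
      Set.pi Set.univ (fun _ : κ => Set.Ici (0 : ℝ)) := by
    ext x
    simp only [Set.mem_preimage, Set.mem_pi, Set.mem_univ, true_imp_iff, Set.mem_Ici]
    have : b.equivFunL.symm x = ∑ i, x i • b i := b.equivFun_symm_apply x
    rw [this, SetLike.mem_coe, sum_smul_mem_cone b.linearIndependent]
    simp
  rw [latticeIntegral, map_volume_eq_normalized b]
  refine (MeasurableEmbedding.setIntegral_map
    b.equivFunL.symm.toHomeomorph.measurableEmbedding _ _).trans ?_
  rw [← hpre]
  refine setIntegral_congr_fun (hpre ▸ MeasurableSet.univ_pi fun _ => measurableSet_Ici)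
    fun x _ => congrArg g ?_
  exact b.equivFun_symm_apply x

theorem integral_Ici_exp_mul {a : ℝ} (ha : a < 0) :
    ∫ x in Set.Ici (0 : ℝ), Real.exp (a * x) = (-a)⁻¹ := by
  rw [integral_Ici_eq_integral_Ioi, integral_exp_mul_Ioi ha]
  simp [neg_div, inv_neg]

variable {ι : Type*} [Fintype ι]

theorem coneIntegral_congr (M : Submodule ℤ X) (F : PointedCone ℝ X) {G : Type*}
    [NormedAddCommGroup G] [NormedSpace ℝ G] {g h : X → G} (hgh : ∀ x ∈ F, g x = h x)
    (hF : IsClosed (F : Set X)) :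
    coneIntegral M F g = coneIntegral M F h := by
  let mX : MeasurableSpace (coneSpan F) := borel _
  have : BorelSpace (coneSpan F) := ⟨rfl⟩
  refine setIntegral_congr_fun ?_ fun x hx => hgh x hx
  exact (hF.preimage (coneSpan F).subtypeL.continuous).measurableSet

theorem coneIntegral_const_mul_ofReal (M : Submodule ℤ X) (F : PointedCone ℝ X) (c : ℂ)
    (g : X → ℝ) : coneIntegral M F (fun x => c * (g x : ℂ)) = c * (coneIntegral M F g : ℝ) := by
  let mX : MeasurableSpace (coneSpan F) := borel _
  have : BorelSpace (coneSpan F) := ⟨rfl⟩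
  rw [coneIntegral, latticeIntegral, integral_const_mul]
  congr 1
  exact integral_ofReal

/-- The cone is the image of a closed set of coefficients under an injective linear map of
finite-dimensional spaces, which is a closed embedding. -/
theorem isClosed_cone {v : ι → X} (hv : LinearIndependent ℝ v) (s : Finset ι) :
    IsClosed (cone v s : Set X) := by
  have hinj : LinearMap.ker (Fintype.linearCombination ℝ v) = ⊥ :=
    LinearMap.ker_eq_bot.2 hv.fintypeLinearCombination_injective
  have hemb := LinearMap.isClosedEmbedding_of_injective hinj
  have : (cone v s : Set X) = Fintype.linearCombination ℝ v ''
      {c | (∀ i, 0 ≤ c i) ∧ ∀ i, i ∉ s → c i = 0} := by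
    ext x
    rw [SetLike.mem_coe, mem_cone]
    simp [Fintype.linearCombination_apply, and_assoc]
  rw [this, ← hemb.isClosed_iff_image_isClosed]
  have : {c : ι → ℝ | (∀ i, 0 ≤ c i) ∧ ∀ i, i ∉ s → c i = 0} =
      (⋂ i, {c | 0 ≤ c i}) ∩ ⋂ i, ⋂ (_ : i ∉ s), {c | c i = 0} := by
    ext c
    simp
  rw [this]
  exact (isClosed_iInter fun i => isClosed_le continuous_const (continuous_apply i)).inter
    (isClosed_iInter fun i => isClosed_iInter fun _ =>
      isClosed_eq (continuous_apply i) continuous_const)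

/-- `∫_F e^ξ` for the face `F` generated by the vectors `v i`, `i ∈ t`. -/
theorem coneIntegral_exp {M : Submodule ℤ X} {v : ι → X} (h : IsLatticeBasis M v)
    (t : Finset ι) (ξ : StrongDual ℝ X) (hξ : ∀ i ∈ t, ξ (v i) < 0) :
    coneIntegral M (cone v t) (fun x => Real.exp (ξ x)) = ∏ i ∈ t, (-ξ (v i))⁻¹ := by
  classical
  let K := coneSpan (cone v t)
  have hK' : K = Submodule.span ℝ (Set.range fun i : t => v i) := by
    rw [show (Set.range fun i : t => v i) = v '' (t : Set ι) from
      (Set.image_eq_range v (t : Set ι)).symm, ← coneSpan_cone]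
  have hmem : ∀ i : t, v i ∈ K := fun i => hK' ▸ Submodule.subset_span ⟨i, rfl⟩
  let w : t → K := fun i => ⟨v i, hmem i⟩
  have hw : LinearIndependent ℝ w := LinearIndependent.of_comp K.subtype
    (h.linearIndependent.comp (fun i : t => (i : ι)) Subtype.val_injective)
  have hw' : ⊤ ≤ Submodule.span ℝ (Set.range w) := by
    rintro ⟨x, hx⟩ -
    rw [hK', Submodule.mem_span_range_iff_exists_fun] at hx
    obtain ⟨c, hc⟩ := hx
    rw [Submodule.mem_span_range_iff_exists_fun]
    exact ⟨c, Subtype.ext (by simpa [w] using hc)⟩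
  let b := Module.Basis.mk hw hw'
  have hb : (b : t → K) = w := Module.Basis.coe_mk hw hw'
  have hcone : cone v t = cone (fun i : t => ((w i : K) : X)) Finset.univ := by
    simp only [cone, w]
    congr 1
    ext x
    simp
  have h1 : coneIn (cone v t) K = cone b Finset.univ := by
    rw [hb, hcone, coneIn_cone]
  have h2 : Submodule.span ℤ (Set.range b) = latticeIn M K := by
    rw [hb]
    ext x
    rw [mem_latticeIn, ← h.span_eq, mem_span_range_int_iff, mem_span_range_int_iff]
    constructor
    · rintro ⟨c, hc⟩
      refine ⟨fun i => if hi : i ∈ t then c ⟨i, hi⟩ else 0, ?_⟩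
      rw [← hc, ← Finset.sum_subset (Finset.subset_univ t), ← Finset.sum_coe_sort t]
      · simp [w]
      · intro i _ hi
        simp [hi]
    · rintro ⟨c, hc⟩
      have hx : (x : X) ∈ Submodule.span ℝ (v '' (t : Set ι)) := by
        rw [← coneSpan_cone]; exact x.2
      rw [← hc, mem_span_image_iff h.linearIndependent] at hx
      refine ⟨fun i => c i, Subtype.ext ?_⟩
      rw [← hc, ← Finset.sum_subset (Finset.subset_univ t), ← Finset.sum_coe_sort t]
      · simp [w]
      · intro i _ hi
        rw [hx i hi, zero_smul]
  change latticeIntegral (latticeIn M K) (coneIn (cone v t) K : Set K)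
    (fun x => Real.exp (ξ (x : X))) = _
  rw [h1, latticeIntegral_cone_univ b h2, hb]
  have h3 : ∀ x : t → ℝ, Real.exp (ξ ((∑ i, x i • w i : K) : X)) =
      ∏ i, (fun (i : t) y => Real.exp (ξ (v i) * y)) i (x i) := by
    intro x
    rw [← Real.exp_sum]
    congr 1
    simp [w, mul_comm]
  simp_rw [h3]
  rw [volume_pi, Measure.restrict_pi_pi, integral_fintype_prod_eq_prod
    (f := fun (i : t) y => Real.exp (ξ (v i) * y)), ← Finset.prod_coe_sort t]
  exact Finset.prod_congr rfl fun i _ => integral_Ici_exp_mul (hξ i i.2)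

end ConeIntegrals

/-! ### Schwartz functions that agree with an exponential near a cone -/

section Exponentials

variable {X : Type u} [NormedAddCommGroup X] [InnerProductSpace ℝ X] [FiniteDimensional ℝ X]

theorem contDiff_cexp_ofReal {n : WithTop ℕ∞} : ContDiff ℝ n (fun t : ℝ => Complex.exp (t : ℂ)) :=
  Complex.contDiff_exp.comp Complex.ofRealCLM.contDiff

theorem contDiff_cexp_dual (ξ : StrongDual ℝ X) {n : WithTop ℕ∞} :
    ContDiff ℝ n (fun x => Complex.exp (ξ x : ℂ)) :=
  contDiff_cexp_ofReal.comp ξ.contDiff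

theorem iteratedDeriv_cexp_ofReal (n : ℕ) :
    iteratedDeriv n (fun t : ℝ => Complex.exp (t : ℂ)) = fun t : ℝ => Complex.exp (t : ℂ) := by
  have h : deriv (fun t : ℝ => Complex.exp (t : ℂ)) = fun t : ℝ => Complex.exp (t : ℂ) := by
    ext t
    have := (Complex.hasDerivAt_exp (t : ℂ)).comp_ofReal
    exact this.deriv
  induction n with
  | zero => rfl
  | succ n ih => rw [iteratedDeriv_succ, ih, h]

theorem iteratedFDeriv_cexp_dual (ξ : StrongDual ℝ X) (k : ℕ) (x : X) (v : Fin k → X) :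
    iteratedFDeriv ℝ k (fun x => Complex.exp (ξ x : ℂ)) x v =
      (∏ i, (ξ (v i) : ℂ)) * Complex.exp (ξ x : ℂ) := by
  have h := ξ.iteratedFDeriv_comp_right (n := ∞) (f := fun t : ℝ => Complex.exp (t : ℂ))
    contDiff_cexp_ofReal x (i := k) (by exact_mod_cast le_top)
  have h' : ((fun t : ℝ => Complex.exp (t : ℂ)) ∘ ξ) = fun x => Complex.exp (ξ x : ℂ) := rfl
  rw [← h', h, ContinuousMultilinearMap.compContinuousLinearMap_apply,
    iteratedFDeriv_apply_eq_iteratedDeriv_mul_prod, iteratedDeriv_cexp_ofReal]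
  simp

theorem norm_iteratedFDeriv_cexp_dual_le (ξ : StrongDual ℝ X) (k : ℕ) (x : X) :
    ‖iteratedFDeriv ℝ k (fun x => Complex.exp (ξ x : ℂ)) x‖ ≤ ‖ξ‖ ^ k * Real.exp (ξ x) := by
  refine ContinuousMultilinearMap.opNorm_le_bound (by positivity) fun v => ?_
  rw [iteratedFDeriv_cexp_dual, norm_mul, Complex.norm_exp, Complex.ofReal_re, norm_prod,
    mul_right_comm]
  gcongr
  calc ∏ i, ‖(ξ (v i) : ℂ)‖ ≤ ∏ i, ‖ξ‖ * ‖v i‖ :=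
        Finset.prod_le_prod (fun i _ => norm_nonneg _) fun i _ => by
          rw [Complex.norm_real]; exact ξ.le_opNorm _
    _ = _ := by simp [Finset.prod_mul_distrib]

/-- The function is bounded and its derivative is supported in `[0, 1]`. -/
theorem hasTemperateGrowth_smoothTransition :
    Function.HasTemperateGrowth Real.smoothTransition := by
  refine Function.HasTemperateGrowth.of_fderiv (k := 0) (C := 1) ?_
    (Real.smoothTransition.contDiff (n := 1)).differentiable_one fun x => ?_
  · refine HasCompactSupport.hasTemperateGrowth ?_ ?_
    · refine HasCompactSupport.of_support_subset_isCompact (isCompact_Icc (a := (0 : ℝ)) (b := 1)) ?_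
      intro x hx
      by_contra hx'
      refine hx ?_
      rw [Set.mem_Icc, not_and_or, not_le, not_le] at hx'
      rcases hx' with h | h
      · have : Real.smoothTransition =ᶠ[𝓝 x] fun _ => 0 := by
          filter_upwards [Iio_mem_nhds h] with y hy
          exact Real.smoothTransition.zero_of_nonpos hy.le
        rw [this.fderiv_eq]
        simp
      · have : Real.smoothTransition =ᶠ[𝓝 x] fun _ => 1 := by
          filter_upwards [Ioi_mem_nhds h] with y hy
          exact Real.smoothTransition.one_of_one_le hy.le
        rw [this.fderiv_eq]
        simp
    · exact (Real.smoothTransition.contDiff (n := ⊤)).fderiv_right (by simp)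
  · rw [pow_zero, mul_one, Real.norm_of_nonneg (Real.smoothTransition.nonneg x)]
    exact Real.smoothTransition.le_one x

theorem HasTemperateGrowth.prod {E κ : Type*} [NormedAddCommGroup E] [NormedSpace ℝ E]
    (s : Finset κ) {f : κ → E → ℝ} (hf : ∀ i ∈ s, (f i).HasTemperateGrowth) :
    Function.HasTemperateGrowth (fun x => ∏ i ∈ s, f i x) := by
  classical
  induction s using Finset.induction_on with
  | empty => simp
  | insert a s ha ih =>
    simp_rw [Finset.prod_insert ha]
    exact (hf a (Finset.mem_insert_self a s)).fun_mul
      (ih fun i hi => hf i (Finset.mem_insert_of_mem hi))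

theorem exists_one_add_pow_mul_exp_le (c : ℝ) (hc : 0 < c) (m : ℕ) :
    ∃ A : ℝ, ∀ y : ℝ, 0 ≤ y → (1 + y) ^ m * Real.exp (-(c * y)) ≤ A := by
  -- The constant comes from `(c (1 + y)) ^ m / m! ≤ exp (c (1 + y))`.
  refine ⟨m.factorial * Real.exp c / c ^ m, fun y hy => ?_⟩
  have h := Real.pow_div_factorial_le_exp (c * (1 + y)) (by positivity) m
  rw [div_le_iff₀ (by positivity), mul_pow, mul_add, mul_one, Real.exp_add] at h
  rw [le_div_iff₀ (by positivity), Real.exp_neg]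
  have he := Real.exp_pos (c * y)
  calc (1 + y) ^ m * (Real.exp (c * y))⁻¹ * c ^ m
      = (c ^ m * (1 + y) ^ m) * (Real.exp (c * y))⁻¹ := by ring
    _ ≤ (Real.exp c * Real.exp (c * y) * m.factorial) * (Real.exp (c * y))⁻¹ := by gcongr
    _ = _ := by field_simp

/-- A function of temperate growth times an exponential that decays on its support is a Schwartz
function. -/
theorem exists_schwartzMap_mul_cexp {χ : X → ℝ} (hχ : χ.HasTemperateGrowth) (ξ : StrongDual ℝ X)
    {A c : ℝ} (hc : 0 < c) (h : ∀ x ∈ tsupport χ, ξ x ≤ A - c * ‖x‖) :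
    ∃ φ : SchwartzMap X ℂ, ∀ x, φ x = (χ x : ℂ) * Complex.exp (ξ x : ℂ) := by
  have hχ' : Function.HasTemperateGrowth (fun x => (χ x : ℂ)) := by fun_prop
  have hsub : tsupport (fun x => (χ x : ℂ)) ⊆ tsupport χ := by
    refine closure_mono fun x hx => ?_
    simpa using hx
  refine ⟨⟨fun x => (χ x : ℂ) * Complex.exp (ξ x : ℂ), hχ'.1.mul (contDiff_cexp_dual ξ), ?_⟩,
    fun x => rfl⟩
  intro k n
  obtain ⟨l, B, hB, hl⟩ := hχ'.norm_iteratedFDeriv_le_uniform n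
  -- The exponential decay absorbs both the Schwartz weight `‖x‖ ^ k` and the growth of order `l` of
  -- the derivatives of `χ`.
  obtain ⟨D, hD⟩ := exists_one_add_pow_mul_exp_le c hc (k + l)
  refine ⟨∑ i ∈ Finset.range (n + 1), (n.choose i : ℝ) * B * ‖ξ‖ ^ (n - i) * (Real.exp A * D),
    fun x => ?_⟩
  have hD0 : 0 ≤ D := le_trans (by positivity) (hD 0 le_rfl)
  refine (mul_le_mul_of_nonneg_left (norm_iteratedFDeriv_mul_le hχ'.1 (contDiff_cexp_dual ξ) x
    (by exact_mod_cast le_top)) (by positivity)).trans ?_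
  rw [Finset.mul_sum]
  refine Finset.sum_le_sum fun i hi => ?_
  by_cases hx : x ∈ tsupport χ
  · have h1 := hl i (Nat.lt_succ_iff.1 (Finset.mem_range.1 hi)) x
    have h2 := norm_iteratedFDeriv_cexp_dual_le ξ (n - i) x
    have h3 : Real.exp (ξ x) ≤ Real.exp A * Real.exp (-(c * ‖x‖)) := by
      rw [← Real.exp_add, ← sub_eq_add_neg]
      exact Real.exp_le_exp.2 (h x hx)
    have h4 : ‖x‖ ^ k ≤ (1 + ‖x‖) ^ k := by gcongr; linarith
    calc _ ≤ (1 + ‖x‖) ^ k * ((n.choose i : ℝ) * (B * (1 + ‖x‖) ^ l) *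
          (‖ξ‖ ^ (n - i) * (Real.exp A * Real.exp (-(c * ‖x‖))))) := by
            gcongr
            exact h2.trans (by gcongr)
      _ = (n.choose i : ℝ) * B * ‖ξ‖ ^ (n - i) *
          (Real.exp A * ((1 + ‖x‖) ^ (k + l) * Real.exp (-(c * ‖x‖)))) := by ring
      _ ≤ _ := by
        gcongr
        exact hD _ (norm_nonneg x)
  · have : iteratedFDeriv ℝ i (fun x => (χ x : ℂ)) x = 0 := by
      by_contra h0
      exact hx (hsub (support_iteratedFDeriv_subset i h0))
    rw [this, norm_zero, mul_zero, zero_mul, mul_zero]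
    positivity

/-- If `ξ` is negative on `C \ {0}`, there is a Schwartz function that agrees with the exponential
of `ξ` near the cone `C`. -/
theorem exists_schwartzMap_eq_cexp {ι : Type*} [Fintype ι] (b : Module.Basis ι ℝ X) (s : Finset ι)
    (ξ : StrongDual ℝ X) (hξ : ∀ i ∈ s, ξ (b i) < 0) :
    ∃ φ : SchwartzMap X ℂ, ∀ x ∈ cone b s, (φ : X → ℂ) =ᶠ[𝓝 x] fun y => Complex.exp (ξ y : ℂ) := by
  classical
  let co : ι → X →L[ℝ] ℝ := fun i => LinearMap.toContinuousLinearMap (b.coord i)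
  -- The cutoff is `1` where all coordinates are at least `-1` and those outside `s` are at most
  -- `1`, which is a neighbourhood of the cone. On its support all coordinates are at least `-2` and
  -- those outside `s` are at most `2`.
  let χ : X → ℝ := fun x => (∏ i, Real.smoothTransition (co i x + 2)) *
    ∏ i ∈ sᶜ, Real.smoothTransition (2 - co i x)
  have hσ := hasTemperateGrowth_smoothTransition
  have hχ : χ.HasTemperateGrowth := by
    refine Function.HasTemperateGrowth.fun_mul (HasTemperateGrowth.prod _ fun i _ => ?_)
      (HasTemperateGrowth.prod _ fun i _ => ?_)
    · exact hσ.comp (f := fun x => co i x + 2) (by fun_prop)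
    · exact hσ.comp (f := fun x => 2 - co i x) (by fun_prop)
  have hsupp : ∀ x ∈ tsupport χ, (∀ i, -2 ≤ co i x) ∧ ∀ i, i ∉ s → co i x ≤ 2 := by
    have hcl : IsClosed ((⋂ i, {x | -2 ≤ co i x}) ∩ ⋂ i, ⋂ (_ : i ∉ s), {x | co i x ≤ 2}) :=
      (isClosed_iInter fun i => isClosed_le continuous_const (co i).continuous).inter
        (isClosed_iInter fun i => isClosed_iInter fun _ =>
          isClosed_le (co i).continuous continuous_const)
    intro x hx
    have := closure_minimal (t := (⋂ i, {x | -2 ≤ co i x}) ∩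
      ⋂ i, ⋂ (_ : i ∉ s), {x | co i x ≤ 2}) ?_ hcl hx
    · simpa using this
    · intro y hy
      have hy' := mul_ne_zero_iff.1 hy
      rw [Finset.prod_ne_zero_iff, Finset.prod_ne_zero_iff] at hy'
      simp only [Set.mem_inter_iff, Set.mem_iInter, Set.mem_ofPred_eq]
      refine ⟨fun i => ?_, fun i hi => ?_⟩
      · have := hy'.1 i (Finset.mem_univ i)
        rw [Ne, Real.smoothTransition.zero_iff_nonpos] at this
        linarith
      · have := hy'.2 i (by simpa using hi)
        rw [Ne, Real.smoothTransition.zero_iff_nonpos] at this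
        linarith
  -- The decay rate is so small that along each generator of the cone the decrease of `ξ` outweighs
  -- `c * ‖x‖`.
  obtain ⟨c, hcs, hc⟩ : ∃ c : ℝ, (∀ i ∈ s, c * ‖b i‖ < -ξ (b i)) ∧ 0 < c := by
    have h1 : ∀ᶠ c : ℝ in 𝓝[>] 0, ∀ i ∈ s, c * ‖b i‖ < -ξ (b i) := by
      refine (Finset.eventually_all s).2 fun i hi => ?_
      have : Tendsto (fun c : ℝ => c * ‖b i‖) (𝓝 0) (𝓝 (0 * ‖b i‖)) :=
        (continuous_id.mul continuous_const).tendsto 0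
      rw [zero_mul] at this
      exact (this.eventually (gt_mem_nhds (neg_pos.2 (hξ i hi)))).filter_mono nhdsWithin_le_nhds
    exact (h1.and self_mem_nhdsWithin).exists
  -- On the support, a coordinate can exceed `2` in absolute value only in the positive direction of
  -- some `i ∈ s`, where its contribution to `ξ x + c * ‖x‖` is nonpositive. All other coordinates
  -- are bounded by `2`, which gives the constant.
  have hdecay : ∀ x ∈ tsupport χ, ξ x ≤ ∑ i, 2 * (|ξ (b i)| + c * ‖b i‖) - c * ‖x‖ := by
    intro x hx
    obtain ⟨h1, h2⟩ := hsupp x hx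
    have hsum : x = ∑ i, co i x • b i := (b.sum_repr x).symm
    have hξx : ξ x = ∑ i, co i x * ξ (b i) := by
      conv_lhs => rw [hsum]
      simp
    have hnx : ‖x‖ ≤ ∑ i, |co i x| * ‖b i‖ := by
      conv_lhs => rw [hsum]
      refine (norm_sum_le _ _).trans (Finset.sum_le_sum fun i _ => ?_)
      rw [norm_smul, Real.norm_eq_abs]
    have h3 : c * ‖x‖ ≤ ∑ i, c * (|co i x| * ‖b i‖) := by
      rw [← Finset.mul_sum]
      gcongr
    have h4 : ∑ i, co i x * ξ (b i) + ∑ i, c * (|co i x| * ‖b i‖) ≤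
        ∑ i, 2 * (|ξ (b i)| + c * ‖b i‖) := by
      rw [← Finset.sum_add_distrib]
      refine Finset.sum_le_sum fun i _ => ?_
      have hcb : 0 ≤ c * ‖b i‖ := by positivity
      have key : |co i x| ≤ 2 → co i x * ξ (b i) + c * (|co i x| * ‖b i‖) ≤
          2 * (|ξ (b i)| + c * ‖b i‖) := by
        intro h
        have e1 : co i x * ξ (b i) ≤ |co i x| * |ξ (b i)| := by
          rw [← abs_mul]; exact le_abs_self _
        have e2 : |co i x| * |ξ (b i)| ≤ 2 * |ξ (b i)| := by gcongr
        have e3 : |co i x| * (c * ‖b i‖) ≤ 2 * (c * ‖b i‖) := by gcongr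
        linarith
      by_cases hi : i ∈ s
      · by_cases hpos : 0 ≤ co i x
        · rw [abs_of_nonneg hpos]
          have e1 : co i x * (c * ‖b i‖) ≤ co i x * (-ξ (b i)) := by
            gcongr
            exact (hcs i hi).le
          have := abs_nonneg (ξ (b i))
          linarith
        · exact key (abs_le.2 ⟨h1 i, by linarith⟩)
      · exact key (abs_le.2 ⟨h1 i, h2 i hi⟩)
    rw [hξx]
    linarith
  obtain ⟨φ, hφ⟩ := exists_schwartzMap_mul_cexp hχ ξ hc hdecay
  refine ⟨φ, fun x hx => ?_⟩
  have hco : ∀ i, 0 ≤ co i x ∧ (i ∉ s → co i x = 0) := by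
    have hsum : x = ∑ i, co i x • b i := (b.sum_repr x).symm
    rw [hsum, sum_smul_mem_cone b.linearIndependent] at hx
    exact fun i => ⟨hx.1 i, hx.2 i⟩
  have h1 : ∀ᶠ y in 𝓝 x, ∀ i, -1 < co i y :=
    eventually_all.2 fun i => (co i).continuous.continuousAt.eventually
      (lt_mem_nhds (by linarith [(hco i).1]))
  have h2 : ∀ᶠ y in 𝓝 x, ∀ i, i ∉ s → co i y < 1 := by
    refine eventually_all.2 fun i => ?_
    by_cases hi : i ∈ s
    · simp [hi]
    · have : ∀ᶠ y in 𝓝 x, co i y < 1 := (co i).continuous.continuousAt.eventually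
        (gt_mem_nhds (by rw [(hco i).2 hi]; exact one_pos))
      exact this.mono fun y hy _ => hy
  filter_upwards [h1, h2] with y hy1 hy2
  have : χ y = 1 := by
    have e1 : ∏ i, Real.smoothTransition (co i y + 2) = 1 :=
      Finset.prod_eq_one fun i _ => Real.smoothTransition.one_of_one_le (by linarith [hy1 i])
    have e2 : ∏ i ∈ sᶜ, Real.smoothTransition (2 - co i y) = 1 :=
      Finset.prod_eq_one fun i hi => Real.smoothTransition.one_of_one_le
        (by linarith [hy2 i (by simpa using hi)])
    simp only [χ, e1, e2, mul_one]
  rw [hφ, this]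
  simp

end Exponentials

/-! ### Calculus and uniqueness of asymptotic expansions -/

section AsymptoticExpansions

theorem HasAsymptoticExpansion.congr' {a b c : ℕ → ℂ} (h : HasAsymptoticExpansion a c)
    (hab : a =ᶠ[atTop] b) : HasAsymptoticExpansion b c := fun K =>
  (h K).congr' (hab.mono fun N hN => by simp only [hN]) EventuallyEq.rfl

theorem HasAsymptoticExpansion.add {a b c d : ℕ → ℂ} (h : HasAsymptoticExpansion a c)
    (h' : HasAsymptoticExpansion b d) :
    HasAsymptoticExpansion (fun N => a N + b N) (fun n => c n + d n) := by
  intro K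
  refine ((h K).add (h' K)).congr_left fun N => ?_
  simp only [mul_add, Finset.sum_add_distrib]
  ring

theorem HasAsymptoticExpansion.zero :
    HasAsymptoticExpansion (fun _ => 0) (fun _ => 0) := by
  intro K
  simpa using Asymptotics.isBigO_zero _ _

theorem HasAsymptoticExpansion.sum {κ : Type*} (s : Finset κ) {a c : κ → ℕ → ℂ}
    (h : ∀ i ∈ s, HasAsymptoticExpansion (a i) (c i)) :
    HasAsymptoticExpansion (fun N => ∑ i ∈ s, a i N) (fun n => ∑ i ∈ s, c i n) := by
  classical
  induction s using Finset.induction_on with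
  | empty => simpa using HasAsymptoticExpansion.zero
  | insert i s hi ih =>
    simp only [Finset.sum_insert hi]
    exact (h i (Finset.mem_insert_self i s)).add
      (ih fun j hj => h j (Finset.mem_insert_of_mem hj))

theorem HasAsymptoticExpansion.const_mul {a c : ℕ → ℂ} (h : HasAsymptoticExpansion a c) (z : ℂ) :
    HasAsymptoticExpansion (fun N => z * a N) (fun n => z * c n) := by
  intro K
  refine ((h K).const_mul_left z).congr_left fun N => ?_
  rw [mul_sub, Finset.mul_sum]
  congr 1
  exact Finset.sum_congr rfl fun n _ => by ring

theorem HasAsymptoticExpansion.shift {a c : ℕ → ℂ} (h : HasAsymptoticExpansion a c) (m : ℕ) :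
    HasAsymptoticExpansion (fun N => ((N : ℂ) ^ m)⁻¹ * a N)
      (fun n => if n < m then 0 else c (n - m)) := by
  intro K
  have hnorm : ∀ k : ℕ, (fun N : ℕ => ((N : ℂ) ^ k)⁻¹) =O[atTop] fun N : ℕ => ((N : ℝ) ^ k)⁻¹ :=
    fun k => Asymptotics.isBigO_of_le _ fun N => by simp
  rcases le_or_gt K m with hK | hK
  · have h0 : (fun N => a N) =O[atTop] fun N : ℕ => ((N : ℝ) ^ 0)⁻¹ := by simpa using h 0
    have h1 : (fun N : ℕ => ((N : ℝ) ^ m)⁻¹) =O[atTop] fun N : ℕ => ((N : ℝ) ^ K)⁻¹ := by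
      refine Asymptotics.IsBigO.of_bound 1 ?_
      filter_upwards [eventually_ge_atTop 1] with N hN
      have hN' : (1 : ℝ) ≤ N := by exact_mod_cast hN
      rw [one_mul, Real.norm_of_nonneg (by positivity), Real.norm_of_nonneg (by positivity)]
      gcongr
    refine (((hnorm m).trans h1).mul h0).congr (fun N => ?_) fun N => by simp
    rw [Finset.sum_eq_zero, sub_zero]
    intro n hn
    simp only [if_pos (lt_of_lt_of_le (Finset.mem_range.1 hn) hK), mul_zero]
  · obtain ⟨j, rfl⟩ := Nat.exists_eq_add_of_le hK.le
    refine ((hnorm m).mul (h j)).congr (fun N => ?_) fun N => by rw [pow_add, mul_inv]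
    have h0 : ∑ n ∈ Finset.range m, ((N : ℂ) ^ n)⁻¹ * (if n < m then 0 else c (n - m)) = 0 :=
      Finset.sum_eq_zero fun n hn => by rw [if_pos (Finset.mem_range.1 hn), mul_zero]
    rw [Finset.sum_range_add]
    simp only [h0, zero_add, mul_sub, Finset.mul_sum]
    congr 1
    refine Finset.sum_congr rfl fun n _ => ?_
    rw [if_neg (by omega), Nat.add_sub_cancel_left, pow_add, mul_inv, mul_assoc]

/-- At the first index `n` where the coefficients might differ, the two expansions up to order `n +
1` leave `N⁻ⁿ (c n - d n) = O(N⁻ⁿ⁻¹)`, so the constant `c n - d n` tends to `0`. -/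
theorem HasAsymptoticExpansion.unique {a c d : ℕ → ℂ} (h : HasAsymptoticExpansion a c)
    (h' : HasAsymptoticExpansion a d) : c = d := by
  ext n
  induction n using Nat.strong_induction_on with
  | _ n ih =>
    have h1 := (h' (n + 1)).sub (h (n + 1))
    have h2 : (fun N : ℕ => ((N : ℂ) ^ n)⁻¹ * (c n - d n)) =O[atTop]
        fun N : ℕ => ((N : ℝ) ^ (n + 1))⁻¹ := by
      refine h1.congr_left fun N => ?_
      have : ∑ k ∈ Finset.range n, ((N : ℂ) ^ k)⁻¹ * c k = ∑ k ∈ Finset.range n, ((N : ℂ) ^ k)⁻¹ * d k :=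
        Finset.sum_congr rfl fun k hk => by rw [ih k (Finset.mem_range.1 hk)]
      rw [Finset.sum_range_succ, Finset.sum_range_succ, this]
      ring
    have h3 : (fun _ : ℕ => c n - d n) =O[atTop] fun N : ℕ => ((N : ℝ))⁻¹ := by
      have h4 : (fun N : ℕ => ((N : ℂ) ^ n)) =O[atTop] fun N : ℕ => ((N : ℝ) ^ n) :=
        Asymptotics.isBigO_of_le _ fun N => by simp
      refine (h4.mul h2).congr' ?_ ?_
      · filter_upwards [eventually_ge_atTop 1] with N hN
        have : (N : ℂ) ≠ 0 := by exact_mod_cast (by omega : N ≠ 0)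
        field_simp
      · filter_upwards [eventually_ge_atTop 1] with N hN
        have : (N : ℝ) ≠ 0 := by exact_mod_cast (by omega : N ≠ 0)
        rw [pow_succ]
        field_simp
    have h5 := h3.trans_tendsto tendsto_inv_atTop_nhds_zero_nat
    have := tendsto_nhds_unique tendsto_const_nhds h5
    exact sub_eq_zero.1 this

end AsymptoticExpansions

/-! ### Homogeneous parts of analytic germs and division by linear functionals -/

section HomogeneousParts

variable {E F : Type*} [NormedAddCommGroup E] [NormedSpace ℝ E] [NormedAddCommGroup F]
  [NormedSpace ℝ F]

theorem homogeneousPart_eq_of_hasFPowerSeriesAt {f : E → ℝ} {p : FormalMultilinearSeries ℝ E ℝ}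
    (h : HasFPowerSeriesAt f p 0) (n : ℕ) (ξ : E) :
    homogeneousPart n f ξ = p n fun _ => ξ := by
  obtain ⟨r, hr⟩ := h
  rw [homogeneousPart, ← hr.factorial_smul ξ n, nsmul_eq_mul, inv_mul_cancel_left₀]
  exact_mod_cast n.factorial_ne_zero

theorem analyticOnNhd_homogeneousPart (n : ℕ) (f : E → ℝ) :
    AnalyticOnNhd ℝ (homogeneousPart n f) Set.univ := by
  intro x _
  have h1 : AnalyticAt ℝ (fun (ξ : E) (_ : Fin n) => ξ) x :=
    (ContinuousLinearMap.pi fun _ : Fin n => ContinuousLinearMap.id ℝ E : E →L[ℝ] (Fin n → E)).analyticAt x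
  exact analyticAt_const.mul ((iteratedFDeriv ℝ n f 0).analyticAt.comp h1)

/-- This is Taylor's formula along `ξ / N`. Together with uniqueness of expansions it turns
identities between germs, even if known only along such rays, into identities between homogeneous
parts. -/
theorem hasAsymptoticExpansion_of_analyticAt {f : E → ℝ} (hf : AnalyticAt ℝ f 0) (ξ : E) :
    HasAsymptoticExpansion (fun N => (f ((N : ℝ)⁻¹ • ξ) : ℂ))
      (fun n => (homogeneousPart n f ξ : ℂ)) := by
  obtain ⟨p, hp⟩ := hf
  intro K
  have h := hp.isBigO_sub_partialSum_pow K
  have ht : Tendsto (fun N : ℕ => (N : ℝ)⁻¹ • ξ) atTop (𝓝 0) := by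
    have := (tendsto_inv_atTop_nhds_zero_nat (𝕜 := ℝ)).smul_const ξ
    simpa using this
  have h1 := h.comp_tendsto ht
  have h2 : (fun N : ℕ => f ((N : ℝ)⁻¹ • ξ) -
      ∑ n ∈ Finset.range K, ((N : ℝ) ^ n)⁻¹ * homogeneousPart n f ξ) =O[atTop]
      fun N : ℕ => ((N : ℝ) ^ K)⁻¹ := by
    refine (h1.congr_left fun N => ?_).trans ?_
    · simp only [Function.comp_apply, zero_add, FormalMultilinearSeries.partialSum]
      congr 1
      refine Finset.sum_congr rfl fun n _ => ?_
      rw [homogeneousPart_eq_of_hasFPowerSeriesAt hp,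
        (p n).map_smul_univ (fun _ => (N : ℝ)⁻¹) (fun _ => ξ)]
      simp
    · refine Asymptotics.IsBigO.of_bound (‖ξ‖ ^ K) (Eventually.of_forall fun N => ?_)
      simp [norm_smul, mul_pow, mul_comm]
  refine Asymptotics.IsBigO.congr_left (f₁ := fun N : ℕ => ((f ((N : ℝ)⁻¹ • ξ) -
      ∑ n ∈ Finset.range K, ((N : ℝ) ^ n)⁻¹ * homogeneousPart n f ξ : ℝ) : ℂ)) ?_ fun N => ?_
  · exact (Asymptotics.isBigO_of_le _ fun N => by rw [Complex.norm_real]).trans h2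
  · push_cast
    rfl

theorem homogeneousPart_comp_clm {f : F → ℝ} (hf : AnalyticAt ℝ f 0) (T : E →L[ℝ] F) (n : ℕ)
    (ξ : E) : homogeneousPart n (fun x => f (T x)) ξ = homogeneousPart n f (T ξ) := by
  have h1 : AnalyticAt ℝ (fun x => f (T x)) 0 :=
    AnalyticAt.comp (by simpa using hf) (T.analyticAt 0)
  have h2 := hasAsymptoticExpansion_of_analyticAt h1 ξ
  have h3 := hasAsymptoticExpansion_of_analyticAt hf (T ξ)
  simp only [map_smul] at h2
  exact_mod_cast congrFun (h2.unique h3) n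

theorem eventuallyEq_of_homogeneousPart_eq {f g : E → ℝ} (hf : AnalyticAt ℝ f 0)
    (hg : AnalyticAt ℝ g 0) (h : ∀ n ξ, homogeneousPart n f ξ = homogeneousPart n g ξ) :
    f =ᶠ[𝓝 0] g := by
  obtain ⟨p, r, hp⟩ := hf
  obtain ⟨q, r', hq⟩ := hg
  have h1 := Metric.eball_mem_nhds (0 : E) hp.r_pos
  have h2 := Metric.eball_mem_nhds (0 : E) hq.r_pos
  filter_upwards [h1, h2] with y hy hy'
  have e1 := hp.hasSum hy
  have e2 := hq.hasSum hy'
  simp only [zero_add] at e1 e2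
  refine e1.unique (e2.congr_fun fun n => ?_)
  rw [← homogeneousPart_eq_of_hasFPowerSeriesAt ⟨r, hp⟩,
    ← homogeneousPart_eq_of_hasFPowerSeriesAt ⟨r', hq⟩, h]

/-- The series of `x ↦ (p x - p (π x)) / ℓ x`, where `x - π x = ℓ x • u`. -/
def divSeries (p : FormalMultilinearSeries ℝ E ℝ) (π : E →L[ℝ] E) (u : E) :
    FormalMultilinearSeries ℝ E ℝ := fun n =>
  ∑ j : Fin (n + 1), ((p (n + 1)).compContinuousLinearMap
    (fun i => if i < j then π else ContinuousLinearMap.id ℝ E)).curryMid j u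

/-- A telescoping sum: the arguments `x` are replaced by `π x` one slot at a time, and each
replacement changes the value by `ℓ x` times a multilinear expression containing `u`. -/
theorem divSeries_apply (p : FormalMultilinearSeries ℝ E ℝ) (π : E →L[ℝ] E) (u : E)
    (ℓ : E →L[ℝ] ℝ) (hπ : ∀ x, x - π x = ℓ x • u) (n : ℕ) (x : E) :
    ℓ x * divSeries p π u n (fun _ => x) =
      p (n + 1) (fun _ => x) - p (n + 1) (fun _ => π x) := by
  let b : ℕ → Fin (n + 1) → E := fun j i => if (i : ℕ) < j then π x else x
  have hj : ∀ j : Fin (n + 1), ℓ x * ((p (n + 1)).compContinuousLinearMap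
      (fun i => if i < j then π else ContinuousLinearMap.id ℝ E)).curryMid j u (fun _ => x) =
      p (n + 1) (b j) - p (n + 1) (b (j + 1)) := by
    intro j
    have e1 : b j = Function.update (b j) j x := by
      ext i; by_cases h : i = j
      · subst h; simp [b]
      · simp [h]
    have e2 : b (j + 1) = Function.update (b j) j (π x) := by
      ext i; by_cases h : i = j
      · subst h; simp [b]
      · have : (i : ℕ) ≠ j := fun h' => h (Fin.ext h')
        simp only [Function.update_of_ne h, b]
        congr 1
        simp only [eq_iff_iff]
        omega
    rw [e2]
    nth_rw 1 [e1]
    rw [← ContinuousMultilinearMap.map_update_sub, hπ, ContinuousMultilinearMap.map_update_smul,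
      smul_eq_mul, ContinuousMultilinearMap.curryMid_apply,
      ContinuousMultilinearMap.compContinuousLinearMap_apply]
    congr 2
    ext i
    rcases lt_trichotomy i j with h | h | h
    · rw [Function.update_of_ne h.ne, if_pos h]
      simp [b, h, Fin.insertNth_apply_below h]
    · subst h
      simp
    · rw [Function.update_of_ne h.ne', if_neg h.le.not_gt]
      have : ¬ (i : ℕ) < j := by
        have : (j : ℕ) < i := h
        omega
      simp [b, this, Fin.insertNth_apply_above h]
  rw [divSeries, sum_apply, Finset.mul_sum]
  simp_rw [hj]
  rw [Fin.sum_univ_eq_sum_range (fun j => p (n + 1) (b j) - p (n + 1) (b (j + 1))),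
    Finset.sum_range_sub']
  have h0 : b 0 = fun _ => x := by ext i; simp [b]
  have h1 : b (n + 1) = fun _ => π x := by ext i; simp only [b, if_pos i.2]
  rw [h0, h1]

theorem norm_divSeries_le (p : FormalMultilinearSeries ℝ E ℝ) (π : E →L[ℝ] E) (u : E) (n : ℕ) :
    ‖divSeries p π u n‖ ≤ (n + 1) * (‖p (n + 1)‖ * (1 + ‖π‖) ^ (n + 1) * ‖u‖) := by
  refine (norm_sum_le _ _).trans ?_
  have : ∀ j ∈ (Finset.univ : Finset (Fin (n + 1))), ‖((p (n + 1)).compContinuousLinearMap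
      (fun i => if i < j then π else ContinuousLinearMap.id ℝ E)).curryMid j u‖ ≤
      ‖p (n + 1)‖ * (1 + ‖π‖) ^ (n + 1) * ‖u‖ := by
    intro j _
    refine (ContinuousLinearMap.le_opNorm _ _).trans ?_
    gcongr
    rw [ContinuousMultilinearMap.norm_curryMid]
    refine (ContinuousMultilinearMap.norm_compContinuousLinearMap_le _ _).trans ?_
    gcongr
    calc _ ≤ ∏ _i : Fin (n + 1), (1 + ‖π‖) := by
          refine Finset.prod_le_prod (fun i _ => norm_nonneg _) fun i _ => ?_
          split_ifs
          · linarith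
          · exact ContinuousLinearMap.norm_id_le.trans (by linarith [norm_nonneg π])
      _ = _ := by simp
  refine (Finset.sum_le_sum this).trans_eq ?_
  simp

/-- The coefficients grow at most geometrically; the number `n + 1` of summands is absorbed by `2 ^
n`, hence the factor `2` in `B`. -/
theorem divSeries_radius_pos {p : FormalMultilinearSeries ℝ E ℝ} (hp : 0 < p.radius)
    (π : E →L[ℝ] E) (u : E) : 0 < (divSeries p π u).radius := by
  obtain ⟨C, r, hC, hr, hCr⟩ := p.le_mul_pow_of_radius_pos hp
  let B : ℝ := 2 * (r * (1 + ‖π‖))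
  have hB : 0 < B := by positivity
  have h : ∀ n, ‖divSeries p π u n‖ * ((B⁻¹).toNNReal : ℝ) ^ n ≤ C * (r * (1 + ‖π‖)) * ‖u‖ := by
    intro n
    rw [Real.coe_toNNReal _ (by positivity)]
    have h2 : ((n : ℝ) + 1) ≤ 2 ^ n := by exact_mod_cast Nat.lt_two_pow_self
    calc _ ≤ (2 ^ n * ((C * r ^ (n + 1)) * (1 + ‖π‖) ^ (n + 1) * ‖u‖)) * B⁻¹ ^ n := by
          gcongr
          refine (norm_divSeries_le p π u n).trans ?_
          gcongr
          exact hCr _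
      _ = C * (r * (1 + ‖π‖)) * ‖u‖ * (B ^ n * B⁻¹ ^ n) := by
          simp only [B, mul_pow, pow_succ]; ring
      _ = _ := by rw [← mul_pow, mul_inv_cancel₀ hB.ne', one_pow, mul_one]
  refine lt_of_lt_of_le ?_ ((divSeries p π u).le_radius_of_bound _ h)
  simpa using hB

/-- Division of an analytic germ by a linear functional. -/
theorem exists_analyticAt_mul_eq {f : E → ℝ} (hf : AnalyticAt ℝ f 0) {ℓ : E →L[ℝ] ℝ}
    (hℓ : ℓ ≠ 0) (h : ∀ n y, ℓ y = 0 → homogeneousPart n f y = 0) :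
    ∃ A : E → ℝ, AnalyticAt ℝ A 0 ∧ ∀ᶠ x in 𝓝 0, f x = ℓ x * A x := by
  obtain ⟨u, hu⟩ : ∃ u, ℓ u = 1 := by
    obtain ⟨w, hw⟩ := DFunLike.ne_iff.1 hℓ
    exact ⟨(ℓ w)⁻¹ • w, by simpa using inv_mul_cancel₀ hw⟩
  -- The projection onto the kernel of `ℓ` along `u`; all homogeneous parts of `f` vanish on its
  -- range.
  let π : E →L[ℝ] E := ContinuousLinearMap.id ℝ E - ℓ.smulRight u
  have hπ : ∀ x, x - π x = ℓ x • u := fun x => by simp [π]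
  have hℓπ : ∀ x, ℓ (π x) = 0 := fun x => by simp [π, hu]
  obtain ⟨p, r, hp⟩ := hf
  have hpz : ∀ n y, ℓ y = 0 → p n (fun _ => y) = 0 := fun n y hy => by
    rw [← homogeneousPart_eq_of_hasFPowerSeriesAt ⟨r, hp⟩, h n y hy]
  have hQ := (divSeries p π u).hasFPowerSeriesOnBall
    (divSeries_radius_pos (lt_of_lt_of_le hp.r_pos hp.r_le) π u)
  refine ⟨(divSeries p π u).sum, ⟨_, _, hQ⟩, ?_⟩
  filter_upwards [Metric.eball_mem_nhds (0 : E) hp.r_pos, Metric.eball_mem_nhds (0 : E) hQ.r_pos]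
    with x hx hx'
  have e1 := hp.hasSum hx
  have e2 := (hQ.hasSum hx').mul_left (ℓ x)
  simp only [zero_add] at e1 e2
  have e3 := (hasSum_nat_add_iff' 1).2 e1
  have e4 : p 0 (fun _ => x) = 0 := by
    rw [← hpz 0 0 (map_zero ℓ)]
    congr 1
    exact Subsingleton.elim _ _
  rw [Finset.sum_range_one, e4, sub_zero] at e3
  refine e3.unique (e2.congr_fun fun n => ?_)
  rw [divSeries_apply p π u ℓ hπ, hpz (n + 1) _ (hℓπ x), sub_zero]

/-- Along `ξ / N` the product of functionals contributes the factor `N ^ (-s.card)`, so it shifts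
the expansion of `A` by `s.card`. -/
theorem homogeneousPart_mul_prod {κ : Type*} (s : Finset κ) {A : E → ℝ} (hA : AnalyticAt ℝ A 0)
    (ℓ : κ → E →L[ℝ] ℝ) {f : E → ℝ} (hf : AnalyticAt ℝ f 0)
    (h : ∀ᶠ x in 𝓝 0, f x = (∏ i ∈ s, ℓ i x) * A x) (n : ℕ) (ξ : E) :
    homogeneousPart n f ξ =
      if n < s.card then 0 else (∏ i ∈ s, ℓ i ξ) * homogeneousPart (n - s.card) A ξ := by
  have h1 := hasAsymptoticExpansion_of_analyticAt hf ξ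
  have h2 := ((hasAsymptoticExpansion_of_analyticAt hA ξ).const_mul
    (∏ i ∈ s, (ℓ i ξ : ℂ))).shift s.card
  have ht : Tendsto (fun N : ℕ => (N : ℝ)⁻¹ • ξ) atTop (𝓝 0) := by
    have := (tendsto_inv_atTop_nhds_zero_nat (𝕜 := ℝ)).smul_const ξ
    simpa using this
  have h3 := h1.unique (h2.congr' ((ht.eventually h).mono fun N hN => ?_))
  · have := congrFun h3 n
    split_ifs at this ⊢ <;> exact_mod_cast this
  · simp only [hN]
    push_cast
    simp only [map_smul, smul_eq_mul, Complex.ofReal_mul, Complex.ofReal_inv,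
      Complex.ofReal_natCast, Finset.prod_mul_distrib, Finset.prod_const, inv_pow]
    ring

theorem eq_of_eq_of_ne_zero {ℓ : E →L[ℝ] ℝ} (hℓ : ℓ ≠ 0) {f g : E → ℝ} (hf : Continuous f)
    (hg : Continuous g) (h : ∀ ξ, ℓ ξ ≠ 0 → f ξ = g ξ) : f = g := by
  refine Continuous.ext_on (s := {ξ | ℓ ξ ≠ 0}) ?_ hf hg fun ξ hξ => h ξ hξ
  have : {ξ : E | ℓ ξ ≠ 0} = (LinearMap.ker (ℓ : E →ₗ[ℝ] ℝ) : Set E)ᶜ := by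
    ext; simp
  rw [this, ← interior_eq_empty_iff_dense_compl]
  by_contra hne
  have := Submodule.eq_top_of_nonempty_interior' _ (Set.nonempty_iff_ne_empty.2 hne)
  rw [LinearMap.ker_eq_top] at this
  exact hℓ (by ext x; exact LinearMap.congr_fun this x)

/-- Division of an analytic germ by a product of linear functionals. -/
theorem exists_analyticAt_prod_mul_eq {κ : Type*} (s : Finset κ) (ℓ : κ → E →L[ℝ] ℝ)
    (hℓ : ∀ i ∈ s, ℓ i ≠ 0) {f : E → ℝ} (hf : AnalyticAt ℝ f 0) (q : ℕ → E → ℝ)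
    (hq : ∀ n, Continuous (q n))
    (hfq : ∀ n ξ, homogeneousPart n f ξ =
      if n < s.card then 0 else (∏ i ∈ s, ℓ i ξ) * q (n - s.card) ξ) :
    ∃ A : E → ℝ, AnalyticAt ℝ A 0 ∧ (∀ᶠ x in 𝓝 0, f x = (∏ i ∈ s, ℓ i x) * A x) ∧
      ∀ n ξ, homogeneousPart n A ξ = q n ξ := by
  classical
  induction s using Finset.induction_on generalizing f with
  | empty => exact ⟨f, hf, by simp, by simpa using hfq⟩
  | insert i s hi ih =>
    obtain ⟨B, hB, hfB⟩ := exists_analyticAt_mul_eq hf (hℓ i (Finset.mem_insert_self i s))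
      (fun n y hy => by
        rw [hfq, Finset.prod_insert hi, hy]
        simp)
    have hB' := homogeneousPart_mul_prod {i} hB ℓ hf (by simpa using hfB)
    have hBq : ∀ n ξ, homogeneousPart n B ξ =
        if n < s.card then 0 else (∏ i ∈ s, ℓ i ξ) * q (n - s.card) ξ := by
      intro n
      -- Cancelling `ℓ i` is possible only off its kernel; the complement of the kernel is dense and
      -- both sides are continuous. This is the reason for requiring continuity of the `q n`.
      refine congrFun (eq_of_eq_of_ne_zero (hℓ i (Finset.mem_insert_self i s))
        (continuousOn_univ.1 (analyticOnNhd_homogeneousPart n B).continuousOn) ?_ fun ξ hξ => ?_)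
      · split_ifs
        · exact continuous_const
        · exact (continuous_finsetProd _ fun i _ => (ℓ i).continuous).mul (hq _)
      · have h1 := hB' (n + 1) ξ
        rw [hfq, Finset.card_insert_of_notMem hi, Finset.prod_insert hi] at h1
        simp only [Finset.card_singleton, Finset.prod_singleton, Nat.add_lt_add_iff_right,
          Nat.add_sub_add_right, Nat.add_sub_cancel] at h1
        rw [if_neg (show ¬ n + 1 < 1 by omega)] at h1
        refine mul_left_cancel₀ hξ (h1.symm.trans ?_)
        split_ifs <;> ring
    obtain ⟨A, hA, hBA, hAq⟩ := ih (fun j hj => hℓ j (Finset.mem_insert_of_mem hj)) hB hBq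
    refine ⟨A, hA, ?_, hAq⟩
    filter_upwards [hfB, hBA] with x h1 h2
    rw [h1, h2, Finset.prod_insert hi, mul_assoc]

end HomogeneousParts

/-! ### Operators on exponentials, and analyticity of symbols -/

section Symbols

variable {X : Type u} [NormedAddCommGroup X] [InnerProductSpace ℝ X] [FiniteDimensional ℝ X]

/-- Differential operators are local, so agreement with the exponential near `x` is enough. -/
theorem IsHomogeneousOperator.apply_eq_symbol_mul {k : ℕ} {D : (X → ℂ) → X → ℂ}
    (hD : IsHomogeneousOperator k D) (ξ : StrongDual ℝ X) {φ : X → ℂ} {x : X}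
    (hφ : φ =ᶠ[𝓝 x] fun y => Complex.exp (ξ y : ℂ)) :
    D φ x = symbol D ξ * Complex.exp (ξ x : ℂ) := by
  unfold symbol
  induction hD using Submodule.span_induction with
  | mem D h =>
    obtain ⟨v, rfl⟩ := h
    have := (EventuallyEq.iteratedFDeriv ℝ hφ k).eq_of_nhds
    simp only [this, iteratedFDeriv_cexp_dual]
    simp
  | zero => simp
  | add D D' _ _ h h' =>
    simp only [Pi.add_apply, h, h', add_mul]
  | smul a D _ h =>
    simp only [Pi.smul_apply, smul_eq_mul, h, mul_assoc]

theorem analyticAt_ofReal_comp {E : Type*} [NormedAddCommGroup E] [NormedSpace ℝ E] {f : E → ℝ}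
    {x : E} (h : AnalyticAt ℝ f x) : AnalyticAt ℝ (fun y => (f y : ℂ)) x :=
  (Complex.ofRealCLM.analyticAt _).comp h

theorem analyticAt_dual_apply (v : X) (ξ : StrongDual ℝ X) :
    AnalyticAt ℝ (fun ξ : StrongDual ℝ X => ξ v) ξ :=
  (ContinuousLinearMap.apply ℝ ℝ v).analyticAt ξ

theorem IsHomogeneousOperator.analyticOnNhd_symbol {k : ℕ} {D : (X → ℂ) → X → ℂ}
    (hD : IsHomogeneousOperator k D) : AnalyticOnNhd ℝ (symbol D) Set.univ := by
  unfold symbol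
  induction hD using Submodule.span_induction with
  | mem D h =>
    obtain ⟨v, rfl⟩ := h
    simp only [iteratedFDeriv_cexp_dual, map_zero, Complex.ofReal_zero, Complex.exp_zero, mul_one]
    exact fun ξ _ => Finset.analyticAt_fun_prod _ fun i _ =>
      analyticAt_ofReal_comp (analyticAt_dual_apply _ _)
  | zero => exact analyticOnNhd_const
  | add D D' _ _ h h' => exact h.add h'
  | smul a D _ h => exact analyticOnNhd_const.mul h

variable {ι : Type*} [Fintype ι]

theorem exists_dual_eq {v : ι → X} (hv : LinearIndependent ℝ v) (c : ι → ℝ) :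
    ∃ ξ : StrongDual ℝ X, ∀ i, ξ (v i) = c i := by
  obtain ⟨g, hg⟩ := LinearMap.exists_extend ((Module.Basis.span hv).constr ℝ c)
  refine ⟨LinearMap.toContinuousLinearMap g, fun i => ?_⟩
  have h := LinearMap.congr_fun hg (Module.Basis.span hv i)
  rw [Module.Basis.constr_basis, LinearMap.comp_apply, Module.Basis.span_apply] at h
  exact h

/-- The functionals that are negative on the chosen vectors form an open set, nonempty by
independence, and the identity theorem applies. Identities proved where sums and integrals converge
thereby extend to the whole dual. -/
theorem eq_of_eq_of_neg {v : ι → X} (hv : LinearIndependent ℝ v) (s : Finset ι)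
    {f g : StrongDual ℝ X → ℂ} (hf : AnalyticOnNhd ℝ f Set.univ) (hg : AnalyticOnNhd ℝ g Set.univ)
    (h : ∀ ξ, (∀ i ∈ s, ξ (v i) < 0) → f ξ = g ξ) : f = g := by
  obtain ⟨ξ₀, hξ₀⟩ := exists_dual_eq hv fun _ => -1
  refine hf.eq_of_eventuallyEq hg (z₀ := ξ₀) ?_
  have : ∀ᶠ ξ in 𝓝 ξ₀, ∀ i ∈ s, ξ (v i) < 0 := by
    refine (Finset.eventually_all s).2 fun i _ => ?_
    exact (ContinuousLinearMap.apply ℝ ℝ (v i)).continuous.continuousAt.eventually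
      (gt_mem_nhds (by simp [hξ₀]))
  exact this.mono h

end Symbols

/-! ### The Todd function -/

section ToddFunction

/-- The function `z / (exp z - 1)`. -/
def toddFun (z : ℝ) : ℝ := (dslope Real.exp 0 z)⁻¹

theorem analyticAt_toddFun : AnalyticAt ℝ toddFun 0 := by
  obtain ⟨p, hp⟩ := (analyticAt_rexp : AnalyticAt ℝ Real.exp 0)
  refine AnalyticAt.inv ⟨_, hp.has_fpower_series_dslope_fslope⟩ ?_
  simp [dslope_same]

theorem toddFun_of_ne_zero {z : ℝ} (hz : z ≠ 0) : toddFun z = -z * (1 - Real.exp z)⁻¹ := by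
  rw [toddFun, dslope_of_ne _ hz, slope_def_field, Real.exp_zero, sub_zero, inv_div,
    div_eq_mul_inv, ← neg_sub (1 : ℝ), inv_neg]
  ring

variable {X : Type u} [NormedAddCommGroup X] [InnerProductSpace ℝ X] [FiniteDimensional ℝ X]
  {ι : Type*}

/-- The product of the functions `z / (exp z - 1)` at `z = ⟨ξ, v i⟩`, `i ∈ s`. -/
def toddProd (v : ι → X) (s : Finset ι) (ξ : StrongDual ℝ X) : ℝ := ∏ i ∈ s, toddFun (ξ (v i))

theorem analyticAt_toddProd (v : ι → X) (s : Finset ι) : AnalyticAt ℝ (toddProd v s) 0 :=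
  Finset.analyticAt_fun_prod _ fun i _ => AnalyticAt.comp (g := toddFun)
    (by simpa using analyticAt_toddFun) (analyticAt_dual_apply (v i) 0)

theorem toddProd_of_neg {v : ι → X} {s : Finset ι} {ξ : StrongDual ℝ X}
    (hξ : ∀ i ∈ s, ξ (v i) < 0) :
    toddProd v s ξ = (∏ i ∈ s, -ξ (v i)) * ∏ i ∈ s, (1 - Real.exp (ξ (v i)))⁻¹ := by
  rw [toddProd, ← Finset.prod_mul_distrib]
  exact Finset.prod_congr rfl fun i hi => toddFun_of_ne_zero (hξ i hi).ne

end ToddFunction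

/-- The part of the hypotheses on the operators that determines their symbols. -/
structure IsAdmissible
    (D : ∀ (X : Type u) [NormedAddCommGroup X] [InnerProductSpace ℝ X] [FiniteDimensional ℝ X],
      Submodule ℤ X → Submodule ℝ X → PointedCone ℝ X → ℕ → ((X → ℂ) → X → ℂ)) : Prop where
  homogeneous : ∀ (X : Type u) [NormedAddCommGroup X] [InnerProductSpace ℝ X]
    [FiniteDimensional ℝ X] (Λ : Submodule ℤ X) (L : Submodule ℝ X) (C : PointedCone ℝ X) (n : ℕ),
    IsRationalSpace Λ → IsRationalSubspace Λ L → IsUnimodular (quotLattice Λ L) C →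
    coneDim C ≤ n → IsHomogeneousOperator (n - coneDim C) (D X Λ L C n)
  orthogonal : ∀ (X : Type u) [NormedAddCommGroup X] [InnerProductSpace ℝ X]
    [FiniteDimensional ℝ X] (Λ : Submodule ℤ X) (L : Submodule ℝ X) (C : PointedCone ℝ X) (n : ℕ),
    IsRationalSpace Λ → IsRationalSubspace Λ L → IsUnimodular (quotLattice Λ L) C →
    coneDim C ≤ n → ∀ ξ : StrongDual ℝ X, symbol (D X Λ L C n) ξ =
      symbol (D Lᗮ (latticeIn (quotLattice Λ L) Lᗮ) ⊥ (coneIn C Lᗮ) n) (ξ ∘L Lᗮ.subtypeL)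
  expansion : ∀ (X : Type u) [NormedAddCommGroup X] [InnerProductSpace ℝ X]
    [FiniteDimensional ℝ X] (Λ : Submodule ℤ X) (C : PointedCone ℝ X),
    IsRationalSpace Λ → IsUnimodular Λ C → ∀ φ : SchwartzMap X ℂ,
      HasAsymptoticExpansion (riemannSum Λ C φ)
        (fun n => ∑ᶠ (F : PointedCone ℝ X) (_ : F.IsFaceOf C ∧ coneDim C ≤ coneDim F + n),
          coneIntegral Λ F (D X Λ (coneSpan F) (C.map (perpProj (coneSpan F))) n φ))

/-! ### The recursion for symbols, from the expansion of Riemann sums -/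

section Recursion

variable {D : ∀ (X : Type u) [NormedAddCommGroup X] [InnerProductSpace ℝ X]
    [FiniteDimensional ℝ X],
    Submodule ℤ X → Submodule ℝ X → PointedCone ℝ X → ℕ → ((X → ℂ) → X → ℂ)}
  {X : Type u} [NormedAddCommGroup X] [InnerProductSpace ℝ X] [FiniteDimensional ℝ X]
  {ι : Type*} [Fintype ι] [DecidableEq ι]

theorem IsLatticeBasis.span_eq_top {Λ : Submodule ℤ X} (hΛ : IsRationalSpace Λ) {v : ι → X}
    (h : IsLatticeBasis Λ v) : ⊤ ≤ Submodule.span ℝ (Set.range v) := by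
  rw [← hΛ.span_eq_top, ← h.span_eq, Submodule.span_span_of_tower]

theorem IsLatticeBasis.isUnimodular_map {Λ : Submodule ℤ X} {L : Submodule ℝ X} {v : ι → X}
    (h : IsLatticeBasis (quotLattice Λ L) v) (s t : Finset ι) :
    IsUnimodular (quotLattice Λ (L ⊔ coneSpan (cone v t)))
      ((cone v s).map (perpProj (L ⊔ coneSpan (cone v t)))) := by
  rw [cone_map_perpProj]
  exact (h.quot t).isUnimodular _

theorem IsLatticeBasis.coneDim_map {Λ : Submodule ℤ X} {L : Submodule ℝ X} {v : ι → X}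
    (h : IsLatticeBasis (quotLattice Λ L) v) (s t : Finset ι) :
    coneDim ((cone v s).map (perpProj (L ⊔ coneSpan (cone v t)))) = (s \ t).card := by
  rw [cone_map_perpProj, coneDim_cone (h.quot t).linearIndependent, card_subtype_notMem]

theorem IsAdmissible.isHomogeneousOperator_face (hD : IsAdmissible D) {Λ : Submodule ℤ X}
    (hΛ : IsRationalSpace Λ) {L : Submodule ℝ X} (hL : IsRationalSubspace Λ L) {v : ι → X}
    (h : IsLatticeBasis (quotLattice Λ L) v) (s t : Finset ι) {n : ℕ} (hn : (s \ t).card ≤ n) :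
    IsHomogeneousOperator (n - (s \ t).card) (D X Λ (L ⊔ coneSpan (cone v t))
      ((cone v s).map (perpProj (L ⊔ coneSpan (cone v t)))) n) := by
  have h1 := hD.homogeneous X Λ (L ⊔ coneSpan (cone v t))
    ((cone v s).map (perpProj (L ⊔ coneSpan (cone v t)))) n hΛ
    (hL.sup_coneSpan h.mem t) (h.isUnimodular_map s t)
    (by rwa [h.coneDim_map])
  rwa [h.coneDim_map] at h1

/-- The sum is the exponential sum at `ξ / N`. Each of its factors, with one power of `N⁻¹` from the
normalization, is `(-ξ (v i))⁻¹` times the Todd function at `ξ (v i) / N`. -/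
theorem riemannSum_eq {Λ : Submodule ℤ X} {v : ι → X} (h : IsLatticeBasis Λ v) (s : Finset ι)
    (ξ : StrongDual ℝ X) (hξ : ∀ i ∈ s, ξ (v i) < 0) {φ : X → ℂ}
    (hφ : ∀ x ∈ cone v s, φ x = Complex.exp (ξ x : ℂ)) {N : ℕ} (hN : 0 < N) :
    riemannSum Λ (cone v s) φ N =
      (∏ i ∈ s, (-ξ (v i) : ℂ)⁻¹) * (toddProd v s ((N : ℝ)⁻¹ • ξ) : ℂ) := by
  have hN' : (0 : ℝ) < N := by exact_mod_cast hN
  have hξN : ∀ i ∈ s, ((N : ℝ)⁻¹ • ξ) (v i) < 0 := fun i hi =>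
    mul_neg_of_pos_of_neg (inv_pos.2 hN') (hξ i hi)
  have h1 := (Complex.hasSum_ofReal.2 (hasSum_exp_latticePoints h s _ hξN)).tsum_eq
  have h2 : ∀ γ : {γ : X // γ ∈ Λ ∧ γ ∈ cone v s}, φ ((N : ℝ)⁻¹ • (γ : X)) =
      (Real.exp (((N : ℝ)⁻¹ • ξ) (γ : X)) : ℂ) := by
    intro γ
    rw [hφ _ ((cone v s).smul_mem (inv_nonneg.2 hN'.le) γ.2.2)]
    simp
  rw [riemannSum, tsum_congr h2, h1, toddProd_of_neg hξN, coneDim_cone h.linearIndependent]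
  push_cast
  rw [← mul_assoc, ← Finset.prod_mul_distrib]
  congr 1
  rw [← inv_pow, ← Finset.prod_const]
  refine Finset.prod_congr rfl fun i hi => ?_
  have : (ξ (v i) : ℂ) ≠ 0 := by exact_mod_cast (hξ i hi).ne
  rw [show ((N : ℝ)⁻¹ • (ξ : X → ℝ)) (v i) = (N : ℝ)⁻¹ * ξ (v i) from rfl]
  push_cast
  field_simp

/-- The recursion for the symbols of the operators attached to the cones in `X`. -/
theorem IsAdmissible.sum_symbol_bot (hD : IsAdmissible D) {Λ : Submodule ℤ X}
    (hΛ : IsRationalSpace Λ) {v : ι → X} (hv : IsLatticeBasis Λ v) (s : Finset ι) (n : ℕ)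
    (ξ : StrongDual ℝ X) :
    ∑ t ∈ s.powerset.filter (fun t => (s \ t).card ≤ n),
      symbol (D X Λ (coneSpan (cone v t)) ((cone v s).map (perpProj (coneSpan (cone v t)))) n) ξ *
        ∏ i ∈ s \ t, (-ξ (v i) : ℂ) = homogeneousPart n (toddProd v s) ξ := by
  have hv' : IsLatticeBasis (quotLattice Λ ⊥) v := by rwa [quotLattice_bot]
  have hop : ∀ t, (s \ t).card ≤ n → IsHomogeneousOperator (n - (s \ t).card)
      (D X Λ (coneSpan (cone v t)) ((cone v s).map (perpProj (coneSpan (cone v t)))) n) := by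
    intro t ht
    have := hD.isHomogeneousOperator_face hΛ (isRationalSubspace_bot Λ) hv' s t ht
    rwa [bot_sup_eq] at this
  refine congrFun (eq_of_eq_of_neg hv.linearIndependent s
    (f := fun ξ => ∑ t ∈ s.powerset.filter (fun t => (s \ t).card ≤ n),
      symbol (D X Λ (coneSpan (cone v t)) ((cone v s).map (perpProj (coneSpan (cone v t)))) n) ξ *
        ∏ i ∈ s \ t, (-ξ (v i) : ℂ))
    (g := fun ξ => (homogeneousPart n (toddProd v s) ξ : ℂ)) ?_ ?_ ?_) ξ
  · refine Finset.analyticOnNhd_fun_sum _ fun t ht => ?_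
    refine (hop t (Finset.mem_filter.1 ht).2).analyticOnNhd_symbol.mul fun η _ => ?_
    exact Finset.analyticAt_fun_prod _ fun i _ =>
      (analyticAt_ofReal_comp (analyticAt_dual_apply _ _)).neg
  · exact fun η _ => analyticAt_ofReal_comp (analyticOnNhd_homogeneousPart _ _ _ trivial)
  clear ξ
  intro ξ hξ
  let b := Module.Basis.mk hv.linearIndependent (hv.span_eq_top hΛ)
  have hb : (b : ι → X) = v := Module.Basis.coe_mk _ _
  obtain ⟨φ, hφ⟩ := exists_schwartzMap_eq_cexp b s ξ (by rwa [hb])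
  rw [hb] at hφ
  have e1 := hD.expansion X Λ (cone v s) hΛ (hv.isUnimodular s) φ
  have e2 : HasAsymptoticExpansion (riemannSum Λ (cone v s) φ)
      (fun n => (∏ i ∈ s, (-ξ (v i) : ℂ)⁻¹) * (homogeneousPart n (toddProd v s) ξ : ℂ)) := by
    refine ((hasAsymptoticExpansion_of_analyticAt (analyticAt_toddProd v s) ξ).const_mul
      _).congr' ?_
    filter_upwards [eventually_gt_atTop 0] with N hN
    exact (riemannSum_eq hv s ξ hξ (fun x hx => (hφ x hx).eq_of_nhds) hN).symm
  have e3 := congrFun (e1.unique e2) n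
  rw [finsum_faces hv.linearIndependent s (fun F => coneDim (cone v s) ≤ coneDim F + n)] at e3
  have hprod : ∏ i ∈ s, (-ξ (v i) : ℂ) ≠ 0 := by
    refine Finset.prod_ne_zero_iff.2 fun i hi => ?_
    rw [neg_ne_zero]
    exact_mod_cast (hξ i hi).ne
  -- Clearing the denominators leaves only the factors with `i ∈ s \ t` in the term of the face `t`.
  have e4 := congrArg (fun z => (∏ i ∈ s, (-ξ (v i) : ℂ)) * z) e3
  rw [Finset.prod_inv_distrib, mul_inv_cancel_left₀ hprod, Finset.mul_sum] at e4
  rw [← e4]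
  have hfilter : s.powerset.filter (fun t => (s \ t).card ≤ n) =
      s.powerset.filter (fun t => coneDim (cone v s) ≤ coneDim (cone v t) + n) := by
    refine Finset.filter_congr fun t ht => ?_
    rw [coneDim_cone hv.linearIndependent, coneDim_cone hv.linearIndependent,
      Finset.card_sdiff_of_subset (Finset.mem_powerset.1 ht)]
    omega
  simp only [hfilter]
  refine Finset.sum_congr rfl fun t ht => ?_
  rw [← hfilter, Finset.mem_filter, Finset.mem_powerset] at ht
  obtain ⟨hts, htn⟩ := ht
  have hint : coneIntegral Λ (cone v t) (D X Λ (coneSpan (cone v t))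
      ((cone v s).map (perpProj (coneSpan (cone v t)))) n φ) =
      symbol (D X Λ (coneSpan (cone v t))
        ((cone v s).map (perpProj (coneSpan (cone v t)))) n) ξ * ∏ i ∈ t, (-ξ (v i) : ℂ)⁻¹ := by
    rw [coneIntegral_congr (h := fun x => symbol (D X Λ (coneSpan (cone v t))
        ((cone v s).map (perpProj (coneSpan (cone v t)))) n) ξ * (Real.exp (ξ x) : ℂ)),
      coneIntegral_const_mul_ofReal, coneIntegral_exp hv t ξ fun i hi => hξ i (hts hi)]
    · push_cast
      rfl
    · intro x hx
      rw [(hop t htn).apply_eq_symbol_mul ξ (hφ x (cone_mono v hts hx))]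
      push_cast
      rfl
    · exact isClosed_cone hv.linearIndependent t
  rw [hint, ← Finset.prod_sdiff hts, Finset.prod_inv_distrib]
  have hprod' : ∏ i ∈ t, (-ξ (v i) : ℂ) ≠ 0 := by
    refine Finset.prod_ne_zero_iff.2 fun i hi => ?_
    rw [neg_ne_zero]
    exact_mod_cast (hξ i (hts hi)).ne
  field_simp

end Recursion

/-! ### Lattices and projections under isometric embeddings -/

section Isometries

variable {X Y : Type u} [NormedAddCommGroup X] [InnerProductSpace ℝ X] [FiniteDimensional ℝ X]
  [NormedAddCommGroup Y] [InnerProductSpace ℝ Y] [FiniteDimensional ℝ Y] {ι : Type*} [Fintype ι]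

theorem coneSpan_cone_comp (j : X →ₗᵢ[ℝ] Y) (v : ι → X) (t : Finset ι) :
    coneSpan (cone (j ∘ v) t) = (coneSpan (cone v t)).map j.toLinearMap := by
  rw [coneSpan_cone, coneSpan_cone, Submodule.map_span, Set.image_comp]
  rfl

theorem perpProj_isometry (j : X →ₗᵢ[ℝ] Y) {L : Submodule ℝ Y} (hj : ∀ x, j x ∈ Lᗮ)
    (K : Submodule ℝ X) (x : X) :
    perpProj (L ⊔ K.map j.toLinearMap) (j x) = j (perpProj K x) := by
  refine perpProj_eq_of_mem ?_ ?_
  · rw [← Submodule.inf_orthogonal, Submodule.mem_inf]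
    refine ⟨hj _, ?_⟩
    rw [Submodule.mem_orthogonal]
    rintro _ ⟨y, hy, rfl⟩
    change inner ℝ (j y) (j _) = 0
    rw [j.inner_map_map]
    exact (Submodule.mem_orthogonal _ _).1 (perpProj_mem K x) y hy
  · rw [← map_sub]
    exact Submodule.mem_sup_right ⟨_, sub_perpProj_mem K x, rfl⟩

theorem isometry_mem_orthogonal {Λ : Submodule ℤ X} (hΛ : IsRationalSpace Λ) {M : Submodule ℤ Y}
    {L : Submodule ℝ Y} (j : X →ₗᵢ[ℝ] Y) (hj : ∀ y, y ∈ quotLattice M L ↔ ∃ x ∈ Λ, j x = y) (x : X) :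
    j x ∈ Lᗮ := by
  have : (⊤ : Submodule ℝ X) ≤ Lᗮ.comap j.toLinearMap := by
    rw [← hΛ.span_eq_top, Submodule.span_le]
    intro y hy
    exact quotLattice_le M L ((hj _).2 ⟨y, hy, rfl⟩)
  exact this trivial

theorem IsLatticeBasis.isometry {Λ : Submodule ℤ X} {M : Submodule ℤ Y} {v : ι → X}
    (h : IsLatticeBasis Λ v) (j : X →ₗᵢ[ℝ] Y) (hj : ∀ y, y ∈ M ↔ ∃ x ∈ Λ, j x = y) :
    IsLatticeBasis M (j ∘ v) where
  linearIndependent := h.linearIndependent.map' j.toLinearMap (LinearMap.ker_eq_bot.2 j.injective)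
  span_eq := by
    ext y
    rw [hj, ← h.span_eq, mem_span_range_int_iff]
    simp only [mem_span_range_int_iff]
    constructor
    · rintro ⟨c, rfl⟩
      exact ⟨_, ⟨c, rfl⟩, by simp⟩
    · rintro ⟨_, ⟨c, rfl⟩, rfl⟩
      exact ⟨c, by simp⟩

/-- Taking the quotient by `L` and then by `K` is taking the quotient by `L ⊔ K`. Thus the embedding
of `Kᗮ` into `Y` again satisfies the lattice condition in `SymbolInvariant`. -/
theorem quotLattice_sup_iff {Λ : Submodule ℤ X} (hΛ : IsRationalSpace Λ) {M : Submodule ℤ Y}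
    {L : Submodule ℝ Y} (j : X →ₗᵢ[ℝ] Y) (hj : ∀ y, y ∈ quotLattice M L ↔ ∃ x ∈ Λ, j x = y)
    (K : Submodule ℝ X) (y : Y) :
    y ∈ quotLattice M (L ⊔ K.map j.toLinearMap) ↔
      ∃ x ∈ latticeIn (quotLattice Λ K) Kᗮ, (j.comp Kᗮ.subtypeₗᵢ) x = y := by
  rw [← quotLattice_quotLattice M (le_sup_left : L ≤ L ⊔ K.map j.toLinearMap)]
  constructor
  · rintro ⟨z, hz, rfl⟩
    obtain ⟨x, hx, rfl⟩ := (hj z).1 hz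
    exact ⟨⟨perpProj K x, perpProj_mem K x⟩, ⟨x, hx, rfl⟩,
      (perpProj_isometry j (isometry_mem_orthogonal hΛ j hj) K x).symm⟩
  · rintro ⟨z, ⟨x, hx, hxz⟩, rfl⟩
    refine ⟨j x, (hj _).2 ⟨x, hx, rfl⟩, ?_⟩
    refine (perpProj_isometry j (isometry_mem_orthogonal hΛ j hj) K x).trans ?_
    exact congrArg j hxz

theorem homogeneousPart_toddProd_comp (v : ι → X) (s : Finset ι) (j : X →ₗᵢ[ℝ] Y) (n : ℕ)
    (η : StrongDual ℝ Y) :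
    homogeneousPart n (toddProd v s) (η ∘L j.toContinuousLinearMap) =
      homogeneousPart n (toddProd (j ∘ v) s) η :=
  (homogeneousPart_comp_clm (analyticAt_toddProd v s)
    (ContinuousLinearMap.precomp ℝ j.toContinuousLinearMap) n η).symm

end Isometries

/-- The symbols of the operators attached to the cones of dimension `d` are invariant under
isometric embeddings onto orthogonal complements of rational subspaces. -/
def SymbolInvariant
    (D : ∀ (X : Type u) [NormedAddCommGroup X] [InnerProductSpace ℝ X] [FiniteDimensional ℝ X],
      Submodule ℤ X → Submodule ℝ X → PointedCone ℝ X → ℕ → ((X → ℂ) → X → ℂ)) (d : ℕ) : Prop :=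
  ∀ (X Y : Type u) [NormedAddCommGroup X] [InnerProductSpace ℝ X] [FiniteDimensional ℝ X]
    [NormedAddCommGroup Y] [InnerProductSpace ℝ Y] [FiniteDimensional ℝ Y]
    (Λ : Submodule ℤ X) (M : Submodule ℤ Y) (L : Submodule ℝ Y) (j : X →ₗᵢ[ℝ] Y)
    (C : PointedCone ℝ X) (n : ℕ), IsRationalSpace Λ → IsRationalSpace M → IsRationalSubspace M L →
    (∀ y, y ∈ quotLattice M L ↔ ∃ x ∈ Λ, j x = y) → IsUnimodular Λ C → coneDim C = d → d ≤ n →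
    ∀ η : StrongDual ℝ Y, symbol (D X Λ ⊥ C n) (η ∘L j.toContinuousLinearMap) =
      symbol (D Y M L (C.map j.toLinearMap) n) η

/-! ### Invariance of symbols under isometries, and the recursion in quotients -/

section Invariance

variable {D : ∀ (X : Type u) [NormedAddCommGroup X] [InnerProductSpace ℝ X]
    [FiniteDimensional ℝ X],
    Submodule ℤ X → Submodule ℝ X → PointedCone ℝ X → ℕ → ((X → ℂ) → X → ℂ)}
  {X Y : Type u} [NormedAddCommGroup X] [InnerProductSpace ℝ X] [FiniteDimensional ℝ X]
  [NormedAddCommGroup Y] [InnerProductSpace ℝ Y] [FiniteDimensional ℝ Y]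
  {ι : Type*} [Fintype ι] [DecidableEq ι]

/-- Condition 1 moves the transverse cone from `X` to `Kᗮ`, with `K` the span of the face.
Invariance for the dimension of this transverse cone is then applied to the composite embedding of
`Kᗮ` into `Y`. -/
theorem SymbolInvariant.face (hD : IsAdmissible D) {Λ : Submodule ℤ X} (hΛ : IsRationalSpace Λ)
    {M : Submodule ℤ Y} (hM : IsRationalSpace M) {L : Submodule ℝ Y} (hL : IsRationalSubspace M L)
    (j : X →ₗᵢ[ℝ] Y) (hj : ∀ y, y ∈ quotLattice M L ↔ ∃ x ∈ Λ, j x = y) {v : ι → X}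
    (hv : IsLatticeBasis Λ v) (s t : Finset ι) (hI : SymbolInvariant D (s \ t).card) {n : ℕ}
    (hn : (s \ t).card ≤ n) (η : StrongDual ℝ Y) :
    symbol (D X Λ (coneSpan (cone v t)) ((cone v s).map (perpProj (coneSpan (cone v t)))) n)
        (η ∘L j.toContinuousLinearMap) =
      symbol (D Y M (L ⊔ coneSpan (cone (j ∘ v) t))
        ((cone (j ∘ v) s).map (perpProj (L ⊔ coneSpan (cone (j ∘ v) t)))) n) η := by
  have hv' : IsLatticeBasis (quotLattice Λ ⊥) v := by rwa [quotLattice_bot]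
  have hb := hv'.quot t
  have hC := cone_map_perpProj ⊥ v s t
  have hK := (isRationalSubspace_bot Λ).sup_coneSpan hv'.mem t
  rw [bot_sup_eq] at hb hC hK
  have hjv := hv.isometry j hj
  let K := coneSpan (cone v t)
  let w : {i // i ∉ t} → Kᗮ := fun i => ⟨perpProj K (v i), perpProj_mem K _⟩
  have hw : IsLatticeBasis (latticeIn (quotLattice Λ K) Kᗮ) w := IsLatticeBasis.latticeIn hb
  have hCw : coneIn ((cone v s).map (perpProj K)) Kᗮ = cone w (s.subtype (· ∉ t)) := by
    rw [hC]
    exact coneIn_cone w _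
  have hdim : coneDim ((cone v s).map (perpProj K)) = (s \ t).card := by
    rw [hC, coneDim_cone hb.linearIndependent, card_subtype_notMem]
  rw [hD.orthogonal X Λ K _ n hΛ hK (by rw [hC]; exact hb.isUnimodular _) (by rwa [hdim]), hCw]
  have hlat := quotLattice_sup_iff hΛ j hj K
  have h1 := hI Kᗮ Y (latticeIn (quotLattice Λ K) Kᗮ) M (L ⊔ K.map j.toLinearMap)
    (j.comp Kᗮ.subtypeₗᵢ) (cone w (s.subtype (· ∉ t))) n (isRationalSpace_orthogonal hΛ hK) hM
    (by
      rw [← coneSpan_cone_comp]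
      exact hL.sup_coneSpan hjv.mem t) hlat (hw.isUnimodular _)
    (by rw [coneDim_cone hw.linearIndependent, card_subtype_notMem]) hn η
  rw [coneSpan_cone_comp]
  have hcone : (cone w (s.subtype (· ∉ t))).map (j.comp Kᗮ.subtypeₗᵢ).toLinearMap =
      (cone (j ∘ v) s).map (perpProj (L ⊔ K.map j.toLinearMap)) := by
    have e1 : (cone w (s.subtype (· ∉ t))).map (j.comp Kᗮ.subtypeₗᵢ).toLinearMap =
        ((cone (fun i : {i // i ∉ t} => perpProj K (v i)) (s.subtype (· ∉ t)))).map
          j.toLinearMap := by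
      rw [cone_map, cone_map]
      rfl
    rw [e1, ← hC, cone_map, cone_map, cone_map]
    congr 1
    ext i
    exact (perpProj_isometry j (isometry_mem_orthogonal hΛ j hj) K (v i)).symm
  rw [← hcone]
  exact h1

theorem cone_map_perpProj_empty (v : ι → X) (s : Finset ι) :
    (cone v s).map (perpProj (⊥ : Submodule ℝ X)) = cone v s := by
  rw [cone_map, perpProj_bot]
  rfl

theorem coneSpan_cone_empty (v : ι → X) : coneSpan (cone v ∅) = ⊥ := by
  rw [coneSpan_cone]
  simp

/-- The term `t = ∅` belongs to the cone itself and is separated from the terms of smaller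
dimension. -/
theorem filter_powerset_eq_insert (s : Finset ι) {n : ℕ} (hn : s.card ≤ n) :
    s.powerset.filter (fun t => (s \ t).card ≤ n) =
      insert ∅ ((s.powerset.filter (fun t => (s \ t).card ≤ n)).erase ∅) := by
  rw [Finset.insert_erase]
  simpa using hn

theorem card_sdiff_lt {s t : Finset ι} {n : ℕ}
    (ht : t ∈ (s.powerset.filter (fun t => (s \ t).card ≤ n)).erase ∅) :
    (s \ t).card < s.card ∧ (s \ t).card ≤ n ∧ t ⊆ s := by
  rw [Finset.mem_erase, Finset.mem_filter, Finset.mem_powerset] at ht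
  refine ⟨?_, ht.2.2, ht.2.1⟩
  rw [Finset.card_sdiff_of_subset ht.2.1]
  have h1 := Finset.card_pos.2 (Finset.nonempty_iff_ne_empty.2 ht.1)
  have h2 := Finset.card_le_card ht.2.1
  omega

theorem mem_latticeIn_orthogonal_iff {M : Submodule ℤ Y} {L : Submodule ℝ Y} (y : Y) :
    y ∈ quotLattice M L ↔ ∃ x ∈ latticeIn (quotLattice M L) Lᗮ, Lᗮ.subtypeₗᵢ x = y :=
  ⟨fun h => ⟨⟨y, quotLattice_le M L h⟩, h, rfl⟩, by rintro ⟨x, hx, rfl⟩; exact hx⟩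

/-- The recursions in `X` and in `Lᗮ` have the same right-hand side, since the Todd product depends
only on the values `η (j (v i))`. By induction the terms `t ≠ ∅` agree, so the terms `t = ∅` agree;
their nonzero linear factors cancel where `η` is negative on the generators. -/
theorem symbolInvariant (hD : IsAdmissible D) (d : ℕ) : SymbolInvariant D d := by
  induction d using Nat.strong_induction_on with
  | _ d ih =>
  intro X Y _ _ _ _ _ _ Λ M L j C n hΛ hM hL hj hC hd hn η
  have := hΛ.discrete
  obtain ⟨k, v, s, hv, rfl⟩ := hC.exists_isLatticeBasis
  rw [coneDim_cone hv.linearIndependent] at hd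
  subst hd
  have hjv := hv.isometry j hj
  let Z := Lᗮ
  let w : Fin k → Z := fun i => ⟨j (v i), quotLattice_le M L (hjv.mem i)⟩
  have hw : IsLatticeBasis (latticeIn (quotLattice M L) Z) w := IsLatticeBasis.latticeIn hjv
  have hΛZ := isRationalSpace_orthogonal hM hL
  have hsw : Z.subtypeₗᵢ ∘ w = j ∘ v := rfl
  have hCw : coneIn (cone (j ∘ v) s) Z = cone w s := coneIn_cone w s
  have hUw : IsUnimodular (quotLattice M L) (cone (j ∘ v) s) := hjv.isUnimodular s
  have hdim : coneDim (cone (j ∘ v) s) = s.card := coneDim_cone hjv.linearIndependent s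
  have hmap : (cone v s).map j.toLinearMap = cone (j ∘ v) s := cone_map _ v s
  rw [hmap]
  refine congrFun (eq_of_eq_of_neg hjv.linearIndependent s
    (f := fun η => symbol (D X Λ ⊥ (cone v s) n) (η ∘L j.toContinuousLinearMap))
    (g := fun η => symbol (D Y M L (cone (j ∘ v) s) n) η) ?_ ?_ ?_) η
  · have h1 := hD.homogeneous X Λ ⊥ (cone v s) n hΛ (isRationalSubspace_bot Λ)
      (by rw [quotLattice_bot]; exact hC) (by rwa [coneDim_cone hv.linearIndependent])
    exact fun η _ => (h1.analyticOnNhd_symbol _ trivial).comp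
      ((ContinuousLinearMap.precomp ℝ j.toContinuousLinearMap).analyticAt η)
  · exact (hD.homogeneous Y M L (cone (j ∘ v) s) n hM hL hUw
      (by rwa [hdim])).analyticOnNhd_symbol
  clear η
  intro η hη
  rw [hD.orthogonal Y M L (cone (j ∘ v) s) n hM hL hUw (by rwa [hdim]), hCw]
  have e1 := hD.sum_symbol_bot hΛ hv s n (η ∘L j.toContinuousLinearMap)
  have e2 := hD.sum_symbol_bot hΛZ hw s n (η ∘L Z.subtypeₗᵢ.toContinuousLinearMap)
  rw [homogeneousPart_toddProd_comp] at e1 e2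
  rw [hsw, ← e1, filter_powerset_eq_insert s hn, Finset.sum_insert (Finset.notMem_erase _ _),
    Finset.sum_insert (Finset.notMem_erase _ _), coneSpan_cone_empty, coneSpan_cone_empty,
    cone_map_perpProj_empty, cone_map_perpProj_empty, Finset.sdiff_empty] at e2
  have hsum : ∀ t ∈ (s.powerset.filter (fun t => (s \ t).card ≤ n)).erase ∅,
      symbol (D Z (latticeIn (quotLattice M L) Z) (coneSpan (cone w t))
        ((cone w s).map (perpProj (coneSpan (cone w t)))) n)
          (η ∘L Z.subtypeₗᵢ.toContinuousLinearMap) *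
        ∏ i ∈ s \ t, (-(η ∘L Z.subtypeₗᵢ.toContinuousLinearMap) (w i) : ℂ) =
      symbol (D X Λ (coneSpan (cone v t)) ((cone v s).map (perpProj (coneSpan (cone v t)))) n)
          (η ∘L j.toContinuousLinearMap) *
        ∏ i ∈ s \ t, (-(η ∘L j.toContinuousLinearMap) (v i) : ℂ) := by
    intro t ht
    obtain ⟨h1, h2, -⟩ := card_sdiff_lt ht
    rw [SymbolInvariant.face hD hΛ hM hL j hj hv s t (ih _ h1) h2 η,
      SymbolInvariant.face hD hΛZ hM hL Z.subtypeₗᵢ mem_latticeIn_orthogonal_iff hw s t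
        (ih _ h1) h2 η]
    rfl
  rw [Finset.sum_congr rfl hsum, add_left_inj] at e2
  have hprod : ∏ i ∈ s, (-(η ∘L j.toContinuousLinearMap) (v i) : ℂ) ≠ 0 := by
    refine Finset.prod_ne_zero_iff.2 fun i hi => ?_
    rw [neg_ne_zero]
    exact_mod_cast (hη i hi).ne
  exact (mul_right_cancel₀ hprod e2).symm

/-- The recursion for the symbols of the operators attached to the cones in `X / L`. -/
theorem IsAdmissible.sum_symbol (hD : IsAdmissible D) {Λ : Submodule ℤ X}
    (hΛ : IsRationalSpace Λ) {L : Submodule ℝ X} (hL : IsRationalSubspace Λ L) {v : ι → X}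
    (hv : IsLatticeBasis (quotLattice Λ L) v) (s : Finset ι) (n : ℕ) (ξ : StrongDual ℝ X) :
    ∑ t ∈ s.powerset.filter (fun t => (s \ t).card ≤ n),
      symbol (D X Λ (L ⊔ coneSpan (cone v t))
        ((cone v s).map (perpProj (L ⊔ coneSpan (cone v t)))) n) ξ *
        ∏ i ∈ s \ t, (-ξ (v i) : ℂ) = homogeneousPart n (toddProd v s) ξ := by
  let w : ι → Lᗮ := fun i => ⟨v i, quotLattice_le Λ L (hv.mem i)⟩
  have hw : IsLatticeBasis (latticeIn (quotLattice Λ L) Lᗮ) w := IsLatticeBasis.latticeIn hv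
  have hΛZ := isRationalSpace_orthogonal hΛ hL
  have hsw : Lᗮ.subtypeₗᵢ ∘ w = v := rfl
  have e2 := hD.sum_symbol_bot hΛZ hw s n (ξ ∘L Lᗮ.subtypeₗᵢ.toContinuousLinearMap)
  rw [homogeneousPart_toddProd_comp, hsw] at e2
  rw [← e2]
  refine Finset.sum_congr rfl fun t ht => ?_
  rw [SymbolInvariant.face hD hΛZ hΛ hL Lᗮ.subtypeₗᵢ mem_latticeIn_orthogonal_iff hw s t
    (symbolInvariant hD _) (Finset.mem_filter.1 ht).2 ξ]
  rfl

end Invariance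

/-! ### Homogeneous parts under restriction of functionals -/

section Precomposition

variable {E F : Type*} [NormedAddCommGroup E] [NormedSpace ℝ E] [NormedAddCommGroup F]
  [NormedSpace ℝ F]

theorem analyticAt_comp_dual (j : E →L[ℝ] F) (η : StrongDual ℝ F) :
    AnalyticAt ℝ (fun ξ : StrongDual ℝ F => (ξ ∘L j : StrongDual ℝ E)) η :=
  ContinuousLinearMap.analyticAt (ContinuousLinearMap.precomp ℝ j) η

theorem homogeneousPart_comp_dual {f : StrongDual ℝ E → ℝ} (hf : AnalyticAt ℝ f 0)
    (j : E →L[ℝ] F) (n : ℕ) (ξ : StrongDual ℝ F) :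
    homogeneousPart n (fun η : StrongDual ℝ F => f (η ∘L j)) ξ = homogeneousPart n f (ξ ∘L j) :=
  homogeneousPart_comp_clm hf (ContinuousLinearMap.precomp ℝ j) n ξ

end Precomposition

/-! ### The recursion for Berline–Vergne functions -/

section BerlineVergneRecursion

variable {X : Type u} [NormedAddCommGroup X] [InnerProductSpace ℝ X] [FiniteDimensional ℝ X]
  {ι : Type*} [Fintype ι] [DecidableEq ι]

theorem neg_on_cone_iff {v : ι → X} (hv : LinearIndependent ℝ v) (s : Finset ι)
    (ξ : StrongDual ℝ X) :
    (∀ x ∈ cone v s, x ≠ 0 → ξ x < 0) ↔ ∀ i ∈ s, ξ (v i) < 0 := by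
  refine ⟨fun h i hi => h _ (mem_cone_of_mem hi) (hv.ne_zero i), fun h x hx hx0 => ?_⟩
  obtain ⟨c, hc, hc', rfl⟩ := mem_cone.1 hx
  obtain ⟨i, -, hi⟩ := Finset.exists_ne_zero_of_sum_ne_zero hx0
  have hci : c i ≠ 0 := fun h0 => hi (by rw [h0, zero_smul])
  have his : i ∈ s := by
    by_contra his
    exact hci (hc' i his)
  simp only [map_sum, map_smul, smul_eq_mul]
  refine Finset.sum_neg' (fun j _ => ?_) ⟨i, Finset.mem_univ i, ?_⟩
  · by_cases hj : j ∈ s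
    · exact mul_nonpos_of_nonneg_of_nonpos (hc j) (h j hj).le
    · rw [hc' j hj, zero_mul]
  · exact mul_neg_of_pos_of_neg (lt_of_le_of_ne (hc i) hci.symm) (h i his)

/-- The identity that characterizes the Berline–Vergne functions, with the sum and the integrals
evaluated. -/
theorem tsum_exp_eq_finsum_iff {M : Submodule ℤ X} {v : ι → X} (hv : IsLatticeBasis M v)
    (s : Finset ι) (ξ : StrongDual ℝ X) (hξ : ∀ i ∈ s, ξ (v i) < 0) (m : PointedCone ℝ X → ℝ) :
    (∑' γ : {γ : X // γ ∈ M ∧ γ ∈ cone v s}, Real.exp (ξ (γ : X)) =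
      ∑ᶠ (F : PointedCone ℝ X) (_ : F.IsFaceOf (cone v s)),
        m F * coneIntegral M F (fun x => Real.exp (ξ x))) ↔
    toddProd v s ξ = ∑ t ∈ s.powerset, (∏ i ∈ s \ t, -ξ (v i)) * m (cone v t) := by
  have h1 := finsum_faces hv.linearIndependent s (fun _ => True)
    (fun F => m F * coneIntegral M F (fun x => Real.exp (ξ x)))
  simp only [and_true, Finset.filter_true] at h1
  have hprod : ∏ i ∈ s, -ξ (v i) ≠ 0 :=
    Finset.prod_ne_zero_iff.2 fun i hi => neg_ne_zero.2 (hξ i hi).ne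
  rw [h1, (hasSum_exp_latticePoints hv s ξ hξ).tsum_eq, toddProd_of_neg hξ,
    ← mul_right_inj' hprod, Finset.mul_sum]
  refine Eq.congr_right (Finset.sum_congr rfl fun t ht => ?_)
  rw [Finset.mem_powerset] at ht
  rw [coneIntegral_exp hv t ξ fun i hi => hξ i (ht hi), ← Finset.prod_sdiff ht,
    Finset.prod_inv_distrib]
  have hprod' : ∏ i ∈ t, -ξ (v i) ≠ 0 :=
    Finset.prod_ne_zero_iff.2 fun i hi => neg_ne_zero.2 (hξ i (ht hi)).ne
  field_simp

/-- The recursion for the homogeneous parts of the Berline–Vergne functions. -/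
theorem IsBerlineVergneFamily.sum_homogeneousPart {Λ : Submodule ℤ X}
    {μ : (L : Submodule ℝ X) → PointedCone ℝ X → StrongDual ℝ Lᗮ → ℝ}
    (hμ : IsBerlineVergneFamily Λ μ) {L : Submodule ℝ X} (hL : IsRationalSubspace Λ L) {v : ι → X}
    (hv : IsLatticeBasis (quotLattice Λ L) v) (s : Finset ι) (n : ℕ) (ξ : StrongDual ℝ X)
    (hξ : ∀ i ∈ s, ξ (v i) < 0) :
    ∑ t ∈ s.powerset.filter (fun t => (s \ t).card ≤ n),
      homogeneousPart (n - (s \ t).card) (μ (L ⊔ coneSpan (cone v t))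
        ((cone v s).map (perpProj (L ⊔ coneSpan (cone v t)))))
          (ξ ∘L (L ⊔ coneSpan (cone v t))ᗮ.subtypeL) * ∏ i ∈ s \ t, -ξ (v i) =
      homogeneousPart n (toddProd v s) ξ := by
  have h1 := hasAsymptoticExpansion_of_analyticAt (analyticAt_toddProd v s) ξ
  have h2 := HasAsymptoticExpansion.sum s.powerset fun t _ =>
    ((hasAsymptoticExpansion_of_analyticAt (hμ.analytic _ _ (hL.sup_coneSpan hv.mem t)
      (hv.isUnimodular_map s t)) (ξ ∘L (L ⊔ coneSpan (cone v t))ᗮ.subtypeL)).const_mul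
      (∏ i ∈ s \ t, (-ξ (v i) : ℂ))).shift (s \ t).card
  have ht : Tendsto (fun N : ℕ => (N : ℝ)⁻¹ • ξ) atTop (𝓝 0) := by
    have := (tendsto_inv_atTop_nhds_zero_nat (𝕜 := ℝ)).smul_const ξ
    simpa using this
  -- The identity holds only near `0`, but `ξ / N` enters that neighbourhood for large `N` and stays
  -- negative on the generators.
  have h3 := ht.eventually (hμ.sum_eq L (cone v s) hL (hv.isUnimodular s))
  have h4 := congrFun (h1.unique (h2.congr' ?_)) n
  · have h5 : ∑ t ∈ s.powerset, (if n < (s \ t).card then 0 else (∏ i ∈ s \ t, -ξ (v i)) *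
        homogeneousPart (n - (s \ t).card) (μ (L ⊔ coneSpan (cone v t))
          ((cone v s).map (perpProj (L ⊔ coneSpan (cone v t)))))
          (ξ ∘L (L ⊔ coneSpan (cone v t))ᗮ.subtypeL)) = homogeneousPart n (toddProd v s) ξ := by
      have h6 := h4.symm
      simp only [← Complex.ofReal_neg, ← Complex.ofReal_prod, ← Complex.ofReal_mul] at h6
      rw [← Complex.ofReal_inj, ← h6, Complex.ofReal_sum]
      refine Finset.sum_congr rfl fun t _ => ?_
      split_ifs <;> simp
    rw [← h5, Finset.sum_filter]
    refine Finset.sum_congr rfl fun t _ => ?_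
    by_cases hn : n < (s \ t).card
    · rw [if_pos hn, if_neg (by omega)]
    · rw [if_neg hn, if_pos (by omega), mul_comm]
  · filter_upwards [h3, eventually_gt_atTop 0] with N hN hN0
    have hN' : (0 : ℝ) < N := by exact_mod_cast hN0
    have hξN : ∀ i ∈ s, ((N : ℝ)⁻¹ • ξ) (v i) < 0 := fun i hi =>
      mul_neg_of_pos_of_neg (inv_pos.2 hN') (hξ i hi)
    have h6 := (tsum_exp_eq_finsum_iff hv s _ hξN (fun F => μ (L ⊔ coneSpan F)
      ((cone v s).map (perpProj (L ⊔ coneSpan F)))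
        (((N : ℝ)⁻¹ • ξ) ∘L (L ⊔ coneSpan F)ᗮ.subtypeL))).1
      (hN ((neg_on_cone_iff hv.linearIndependent s _).2 hξN))
    rw [h6, Complex.ofReal_sum]
    refine Finset.sum_congr rfl fun t _ => ?_
    have h7 : ∏ i ∈ s \ t, -((N : ℝ)⁻¹ • ξ) (v i) =
        ((N : ℝ) ^ (s \ t).card)⁻¹ * ∏ i ∈ s \ t, -ξ (v i) := by
      rw [← inv_pow, ← Finset.prod_const, ← Finset.prod_mul_distrib]
      refine Finset.prod_congr rfl fun i _ => ?_
      rw [show ((N : ℝ)⁻¹ • ξ) (v i) = (N : ℝ)⁻¹ * ξ (v i) from rfl]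
      ring
    rw [h7, ContinuousLinearMap.smul_comp]
    push_cast
    ring

theorem sup_coneSpan_cone_empty (L : Submodule ℝ X) (v : ι → X) :
    L ⊔ coneSpan (cone v ∅) = L := by
  rw [coneSpan_cone_empty, sup_bot_eq]

theorem cone_map_perpProj_self {L : Submodule ℝ X} {v : ι → X} (hv : ∀ i, v i ∈ Lᗮ)
    (s : Finset ι) : (cone v s).map (perpProj L) = cone v s := by
  rw [cone_map]
  congr 1
  ext i
  exact perpProj_of_mem (hv i)

end BerlineVergneRecursion

/-! ### Comparison of the two recursions, and existence of the Berline–Vergne functions -/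

section Main

variable {D : ∀ (X : Type u) [NormedAddCommGroup X] [InnerProductSpace ℝ X]
    [FiniteDimensional ℝ X],
    Submodule ℤ X → Submodule ℝ X → PointedCone ℝ X → ℕ → ((X → ℂ) → X → ℂ)}
  {X : Type u} [NormedAddCommGroup X] [InnerProductSpace ℝ X] [FiniteDimensional ℝ X]

/-- Both sides solve the same recursion. By induction on the dimension the terms `t ≠ ∅` agree, and
the product in the term `t = ∅` cancels on the open set of negative `ξ`. -/
theorem IsAdmissible.symbol_eq_homogeneousPart (hD : IsAdmissible D) {Λ : Submodule ℤ X}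
    (hΛ : IsRationalSpace Λ) {μ : (L : Submodule ℝ X) → PointedCone ℝ X → StrongDual ℝ Lᗮ → ℝ}
    (hμ : IsBerlineVergneFamily Λ μ) {L : Submodule ℝ X} {C : PointedCone ℝ X} {n : ℕ}
    (hL : IsRationalSubspace Λ L) (hC : IsUnimodular (quotLattice Λ L) C) (hn : coneDim C ≤ n)
    (ξ : StrongDual ℝ X) :
    symbol (D X Λ L C n) ξ =
      (homogeneousPart (n - coneDim C) (μ L C) (ξ ∘L Lᗮ.subtypeL) : ℝ) := by
  induction hd : coneDim C using Nat.strong_induction_on generalizing L C n ξ with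
  | _ d ih =>
  have hop := hD.homogeneous X Λ L C n hΛ hL hC hn
  have := discreteTopology_quotLattice hΛ hL
  obtain ⟨k, v, s, hv, rfl⟩ := hC.exists_isLatticeBasis
  rw [coneDim_cone hv.linearIndependent] at hd hn
  subst hd
  have hvL : ∀ i, v i ∈ Lᗮ := fun i => quotLattice_le Λ L (hv.mem i)
  refine congrFun (eq_of_eq_of_neg hv.linearIndependent s
    (f := fun ξ => symbol (D X Λ L (cone v s) n) ξ)
    (g := fun ξ => ((homogeneousPart (n - s.card) (μ L (cone v s))
      (ξ ∘L Lᗮ.subtypeL) : ℝ) : ℂ)) hop.analyticOnNhd_symbol ?_ ?_) ξ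
  · intro η _
    have h := analyticOnNhd_homogeneousPart (n - s.card) (μ L (cone v s)) (η ∘L Lᗮ.subtypeL)
      trivial
    exact analyticAt_ofReal_comp (h.comp_of_eq (analyticAt_comp_dual Lᗮ.subtypeL η) rfl)
  clear ξ
  intro ξ hξ
  have e1 := hD.sum_symbol hΛ hL hv s n ξ
  have e2 := hμ.sum_homogeneousPart hL hv s n ξ hξ
  rw [← e2, filter_powerset_eq_insert s hn, Finset.sum_insert (Finset.notMem_erase _ _),
    Finset.sum_insert (Finset.notMem_erase _ _), sup_coneSpan_cone_empty,
    cone_map_perpProj_self hvL, Finset.sdiff_empty, Complex.ofReal_add, Complex.ofReal_sum] at e1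
  have hsum : ∀ t ∈ (s.powerset.filter (fun t => (s \ t).card ≤ n)).erase ∅,
      symbol (D X Λ (L ⊔ coneSpan (cone v t))
        ((cone v s).map (perpProj (L ⊔ coneSpan (cone v t)))) n) ξ *
        ∏ i ∈ s \ t, (-ξ (v i) : ℂ) =
      ((homogeneousPart (n - (s \ t).card) (μ (L ⊔ coneSpan (cone v t))
        ((cone v s).map (perpProj (L ⊔ coneSpan (cone v t)))))
          (ξ ∘L (L ⊔ coneSpan (cone v t))ᗮ.subtypeL) * ∏ i ∈ s \ t, -ξ (v i) : ℝ) : ℂ) := by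
    intro t ht
    obtain ⟨h1, h2, -⟩ := card_sdiff_lt ht
    rw [ih _ h1 (hL.sup_coneSpan hv.mem t) (hv.isUnimodular_map s t)
      (by rwa [hv.coneDim_map]) ξ (hv.coneDim_map s t)]
    push_cast
    rfl
  rw [Finset.sum_congr rfl hsum, add_left_inj] at e1
  have hprod : ∏ i ∈ s, (-ξ (v i) : ℂ) ≠ 0 := by
    refine Finset.prod_ne_zero_iff.2 fun i hi => ?_
    rw [neg_ne_zero]
    exact_mod_cast (hξ i hi).ne
  refine mul_right_cancel₀ hprod (e1.trans ?_)
  push_cast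
  rfl

theorem homogeneousPart_sub {E : Type*} [NormedAddCommGroup E] [NormedSpace ℝ E] {f g : E → ℝ}
    (hf : AnalyticAt ℝ f 0) (hg : AnalyticAt ℝ g 0) (n : ℕ) (ξ : E) :
    homogeneousPart n (fun x => f x - g x) ξ = homogeneousPart n f ξ - homogeneousPart n g ξ := by
  obtain ⟨p, hp⟩ := hf
  obtain ⟨q, hq⟩ := hg
  rw [homogeneousPart_eq_of_hasFPowerSeriesAt hp, homogeneousPart_eq_of_hasFPowerSeriesAt hq]
  exact homogeneousPart_eq_of_hasFPowerSeriesAt (hp.sub hq) n ξ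

theorem homogeneousPart_sum {E κ : Type*} [NormedAddCommGroup E] [NormedSpace ℝ E] (s : Finset κ)
    {f : κ → E → ℝ} (hf : ∀ i ∈ s, AnalyticAt ℝ (f i) 0) (n : ℕ) (ξ : E) :
    homogeneousPart n (fun x => ∑ i ∈ s, f i x) ξ = ∑ i ∈ s, homogeneousPart n (f i) ξ := by
  have h1 := hasAsymptoticExpansion_of_analyticAt (Finset.analyticAt_fun_sum s hf) ξ
  have h2 := HasAsymptoticExpansion.sum s fun i hi =>
    hasAsymptoticExpansion_of_analyticAt (hf i hi) ξ
  simp only [← Complex.ofReal_sum] at h2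
  exact_mod_cast congrFun (h1.unique h2) n

/-- The functional `ξ ↦ -⟨ξ, x⟩` on the dual space. -/
def negEval (x : X) : StrongDual ℝ X →L[ℝ] ℝ := -ContinuousLinearMap.apply ℝ ℝ x

theorem negEval_apply (x : X) (ξ : StrongDual ℝ X) : negEval x ξ = -ξ x := rfl

variable {ι : Type*} [Fintype ι] [DecidableEq ι]

theorem analyticAt_prod_negEval_mul {s : Finset ι} {v : ι → X} {A : StrongDual ℝ X → ℝ}
    (hA : AnalyticAt ℝ A 0) :
    AnalyticAt ℝ (fun ξ => (∏ i ∈ s, negEval (v i) ξ) * A ξ) 0 :=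
  (Finset.analyticAt_fun_prod _ fun i _ => (negEval (v i)).analyticAt 0).mul hA

/-- The real part of the recursion for the symbols. -/
theorem IsAdmissible.sum_re_symbol (hD : IsAdmissible D) {Λ : Submodule ℤ X}
    (hΛ : IsRationalSpace Λ) {L : Submodule ℝ X} (hL : IsRationalSubspace Λ L) {v : ι → X}
    (hv : IsLatticeBasis (quotLattice Λ L) v) (s : Finset ι) (n : ℕ) (ξ : StrongDual ℝ X) :
    ∑ t ∈ s.powerset, (if n < (s \ t).card then 0 else (∏ i ∈ s \ t, negEval (v i) ξ) *
      (symbol (D X Λ (L ⊔ coneSpan (cone v t))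
        ((cone v s).map (perpProj (L ⊔ coneSpan (cone v t))))
          (n - (s \ t).card + (s \ t).card)) ξ).re) = homogeneousPart n (toddProd v s) ξ := by
  have h := congrArg Complex.re (hD.sum_symbol hΛ hL hv s n ξ)
  rw [Complex.ofReal_re, Complex.re_sum, Finset.sum_filter] at h
  rw [← h]
  refine Finset.sum_congr rfl fun t _ => ?_
  by_cases hn : n < (s \ t).card
  · rw [if_pos hn, if_neg (by omega)]
  · rw [if_neg hn, if_pos (by omega), Nat.sub_add_cancel (by omega)]
    simp only [← Complex.ofReal_neg, ← Complex.ofReal_prod, Complex.re_mul_ofReal, negEval_apply]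
    rw [mul_comm]

/-- The symbols of the operators attached to a cone are the homogeneous parts of an analytic
germ. -/
theorem IsAdmissible.exists_germ (hD : IsAdmissible D) {Λ : Submodule ℤ X}
    (hΛ : IsRationalSpace Λ) {L : Submodule ℝ X} {C : PointedCone ℝ X}
    (hL : IsRationalSubspace Λ L) (hC : IsUnimodular (quotLattice Λ L) C) :
    ∃ A : StrongDual ℝ X → ℝ, AnalyticAt ℝ A 0 ∧
      ∀ n ξ, homogeneousPart n A ξ = (symbol (D X Λ L C (n + coneDim C)) ξ).re := by
  induction hd : coneDim C using Nat.strong_induction_on generalizing L C with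
  | _ d ih =>
  have hop := fun n => hD.homogeneous X Λ L C (n + coneDim C) hΛ hL hC (Nat.le_add_left _ _)
  have := discreteTopology_quotLattice hΛ hL
  obtain ⟨k, v, s, hv, rfl⟩ := hC.exists_isLatticeBasis
  rw [coneDim_cone hv.linearIndependent] at hd hop
  subst hd
  have hvL : ∀ i, v i ∈ Lᗮ := fun i => quotLattice_le Λ L (hv.mem i)
  have hcard : ∀ t ∈ s.powerset.erase ∅, (s \ t).card < s.card := by
    intro t ht
    refine (card_sdiff_lt (n := s.card) ?_).1
    rw [Finset.mem_erase, Finset.mem_powerset] at ht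
    rw [Finset.mem_erase, Finset.mem_filter, Finset.mem_powerset]
    exact ⟨ht.1, ht.2, Finset.card_le_card Finset.sdiff_subset⟩
  choose! A hA hAs using fun t (ht : t ∈ s.powerset.erase ∅) => ih _ (hcard t ht)
    (hL.sup_coneSpan hv.mem t) (hv.isUnimodular_map s t) (hv.coneDim_map s t)
  -- By the recursion, every homogeneous part of `f` is the product of the `negEval (v i)`, `i ∈ s`,
  -- times the real part of a symbol of `cone v s`, and vanishes in degrees below `s.card`. Division
  -- by this product gives the germ.
  let f : StrongDual ℝ X → ℝ := fun ξ => toddProd v s ξ -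
    ∑ t ∈ s.powerset.erase ∅, (∏ i ∈ s \ t, negEval (v i) ξ) * A t ξ
  have hsum : AnalyticAt ℝ (fun ξ : StrongDual ℝ X =>
      ∑ t ∈ s.powerset.erase ∅, (∏ i ∈ s \ t, negEval (v i) ξ) * A t ξ) 0 :=
    Finset.analyticAt_fun_sum _ fun t ht => analyticAt_prod_negEval_mul (hA t ht)
  have hf : AnalyticAt ℝ f 0 := (analyticAt_toddProd v s).sub hsum
  have hne : ∀ i ∈ s, negEval (v i) ≠ 0 := by
    intro i _ h0
    obtain ⟨ξ, hξ⟩ := exists_dual_eq hv.linearIndependent fun _ => 1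
    have := DFunLike.congr_fun h0 ξ
    rw [negEval_apply, hξ] at this
    norm_num at this
  have hcont : ∀ n, Continuous fun ξ => (symbol (D X Λ L (cone v s) (n + s.card)) ξ).re :=
    fun n => Complex.continuous_re.comp
      (continuousOn_univ.1 (hop n).analyticOnNhd_symbol.continuousOn)
  have hfq : ∀ n ξ, homogeneousPart n f ξ = if n < s.card then 0 else
      (∏ i ∈ s, negEval (v i) ξ) * (symbol (D X Λ L (cone v s) (n - s.card + s.card)) ξ).re := by
    intro n ξ
    have h1 := hD.sum_re_symbol hΛ hL hv s n ξ
    rw [← Finset.add_sum_erase _ _ (Finset.empty_mem_powerset s), Finset.sdiff_empty,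
      sup_coneSpan_cone_empty, cone_map_perpProj_self hvL] at h1
    rw [homogeneousPart_sub (analyticAt_toddProd v s) hsum,
      homogeneousPart_sum _ fun t ht => analyticAt_prod_negEval_mul (hA t ht), ← h1,
      add_sub_assoc, add_eq_left, sub_eq_zero]
    refine Finset.sum_congr rfl fun t ht => ?_
    rw [homogeneousPart_mul_prod (s \ t) (hA t ht) (fun i => negEval (v i))
      (analyticAt_prod_negEval_mul (hA t ht)) (Eventually.of_forall fun _ => rfl), hAs t ht]
  obtain ⟨B, hB, -, hBq⟩ := exists_analyticAt_prod_mul_eq s (fun i => negEval (v i)) hne hf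
    (fun n ξ => (symbol (D X Λ L (cone v s) (n + s.card)) ξ).re) hcont hfq
  exact ⟨B, hB, hBq⟩

/-- By condition 1 the symbols depend only on the restriction of `ξ` to `Lᗮ`, so extending
functionals from `Lᗮ` by the orthogonal projection loses nothing. -/
theorem IsAdmissible.exists_germ_orthogonal (hD : IsAdmissible D) {Λ : Submodule ℤ X}
    (hΛ : IsRationalSpace Λ) {L : Submodule ℝ X} {C : PointedCone ℝ X}
    (hL : IsRationalSubspace Λ L) (hC : IsUnimodular (quotLattice Λ L) C) :
    ∃ A : StrongDual ℝ Lᗮ → ℝ, AnalyticAt ℝ A 0 ∧ ∀ n (ξ : StrongDual ℝ X),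
      homogeneousPart n A (ξ ∘L Lᗮ.subtypeL) = (symbol (D X Λ L C (n + coneDim C)) ξ).re := by
  obtain ⟨A, hA, hAs⟩ := hD.exists_germ hΛ hL hC
  refine ⟨fun η => A (η ∘L Lᗮ.orthogonalProjectionOnto), AnalyticAt.comp
    (by simpa using hA) (analyticAt_comp_dual Lᗮ.orthogonalProjectionOnto 0), fun n ξ => ?_⟩
  rw [homogeneousPart_comp_dual hA, hAs,
    hD.orthogonal X Λ L C _ hΛ hL hC (Nat.le_add_left _ _),
    hD.orthogonal X Λ L C _ hΛ hL hC (Nat.le_add_left _ _)]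
  congr 2
  ext x
  simp

theorem IsAdmissible.exists_isBerlineVergneFamily (hD : IsAdmissible D) {Λ : Submodule ℤ X}
    (hΛ : IsRationalSpace Λ) :
    ∃ μ : (L : Submodule ℝ X) → PointedCone ℝ X → StrongDual ℝ Lᗮ → ℝ,
      IsBerlineVergneFamily Λ μ := by
  have hex : ∀ (L : Submodule ℝ X) (C : PointedCone ℝ X), ∃ A : StrongDual ℝ Lᗮ → ℝ,
      IsRationalSubspace Λ L → IsUnimodular (quotLattice Λ L) C →
      AnalyticAt ℝ A 0 ∧ ∀ n (ξ : StrongDual ℝ X),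
        homogeneousPart n A (ξ ∘L Lᗮ.subtypeL) =
          (symbol (D X Λ L C (n + coneDim C)) ξ).re := by
    intro L C
    by_cases h : IsRationalSubspace Λ L ∧ IsUnimodular (quotLattice Λ L) C
    · obtain ⟨A, hA⟩ := hD.exists_germ_orthogonal hΛ h.1 h.2
      exact ⟨A, fun _ _ => hA⟩
    · exact ⟨0, fun h1 h2 => (h ⟨h1, h2⟩).elim⟩
  choose μ hμ using hex
  refine ⟨μ, fun L C hL hC => (hμ L C hL hC).1, ?_, ?_⟩
  · have hL : IsRationalSubspace Λ (⊤ : Submodule ℝ X) := by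
      simpa [IsRationalSubspace] using hΛ.span_eq_top
    have hv : IsLatticeBasis (quotLattice Λ ⊤) (fun i : Fin 0 => (i.elim0 : X)) := by
      refine ⟨linearIndependent_empty_type, ?_⟩
      rw [Set.range_eq_empty, Submodule.span_empty, eq_comm, eq_bot_iff]
      intro x hx
      simpa using quotLattice_le Λ ⊤ hx
    have hC : IsUnimodular (quotLattice Λ ⊤) (⊥ : PointedCone ℝ X) := by
      rw [← cone_empty (fun i : Fin 0 => (i.elim0 : X))]
      exact hv.isUnimodular _
    have h1 := (hμ ⊤ ⊥ hL hC).2 0 0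
    -- For the zero cone in degree `0` the recursion says that the real part of the symbol is the
    -- empty Todd product, which is `1`.
    have h2 := hD.sum_re_symbol hΛ hL hv ∅ 0 0
    have h0 : ∀ {E : Type u} [NormedAddCommGroup E] [NormedSpace ℝ E] (f : E → ℝ) (ξ : E),
        homogeneousPart 0 f ξ = f 0 := by
      intro E _ _ f ξ
      simp [homogeneousPart]
    rw [h0] at h1 h2
    have hdim : coneDim (⊥ : PointedCone ℝ X) = 0 := by
      rw [← cone_empty (fun i : Fin 0 => (i.elim0 : X)), coneDim_cone hv.linearIndependent]
      rfl
    rw [h1, hdim]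
    rw [Finset.powerset_empty, Finset.sum_singleton, Finset.sdiff_empty, sup_coneSpan_cone_empty,
      cone_map_perpProj_self (fun i => i.elim0), cone_empty] at h2
    simpa [toddProd] using h2
  · intro L C hL hC
    have := discreteTopology_quotLattice hΛ hL
    obtain ⟨k, v, s, hv, rfl⟩ := hC.exists_isLatticeBasis
    have hμt := fun t => hμ _ _ (hL.sup_coneSpan hv.mem t) (hv.isUnimodular_map s t)
    let A : Finset (Fin k) → StrongDual ℝ X → ℝ := fun t ξ => μ (L ⊔ coneSpan (cone v t))
      ((cone v s).map (perpProj (L ⊔ coneSpan (cone v t))))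
      (ξ ∘L (L ⊔ coneSpan (cone v t))ᗮ.subtypeL)
    have hA : ∀ t, AnalyticAt ℝ (A t) 0 := fun t =>
      AnalyticAt.comp (by simpa using (hμt t).1) (analyticAt_comp_dual _ 0)
    have hAs : ∀ t n ξ, homogeneousPart n (A t) ξ = (symbol (D X Λ (L ⊔ coneSpan (cone v t))
        ((cone v s).map (perpProj (L ⊔ coneSpan (cone v t)))) (n + (s \ t).card)) ξ).re := by
      intro t n ξ
      have := (hμt t).2 n ξ
      rw [hv.coneDim_map] at this
      rw [← this]
      exact homogeneousPart_comp_dual (hμt t).1 _ n ξ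
    -- Both germs are analytic with equal homogeneous parts, by the recursion for symbols; hence
    -- they agree near `0`.
    have heq : toddProd v s =ᶠ[𝓝 0]
        fun ξ => ∑ t ∈ s.powerset, (∏ i ∈ s \ t, negEval (v i) ξ) * A t ξ := by
      refine eventuallyEq_of_homogeneousPart_eq (analyticAt_toddProd v s)
        (Finset.analyticAt_fun_sum _ fun t _ => analyticAt_prod_negEval_mul (hA t)) fun n ξ => ?_
      rw [homogeneousPart_sum _ fun t _ => analyticAt_prod_negEval_mul (hA t),
        ← hD.sum_re_symbol hΛ hL hv s n ξ]
      refine Finset.sum_congr rfl fun t _ => ?_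
      rw [homogeneousPart_mul_prod (s \ t) (hA t) (fun i => negEval (v i))
        (analyticAt_prod_negEval_mul (hA t)) (Eventually.of_forall fun _ => rfl), hAs]
    filter_upwards [heq] with ξ hξ hneg
    rw [neg_on_cone_iff hv.linearIndependent] at hneg
    exact (tsum_exp_eq_finsum_iff hv s ξ hneg (fun F => μ (L ⊔ coneSpan F)
      ((cone v s).map (perpProj (L ⊔ coneSpan F)))
        (ξ ∘L (L ⊔ coneSpan F)ᗮ.subtypeL))).2 hξ

end Main

end EulerMaclaurin

end

theorem mainTheorem6
    -- `D X Λ L C n` is the operator on `X` attached to the unimodular cone `C` in `X / L ≅ Lᗮ`;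
    -- for a cone in `X` itself, `L = ⊥`.
    (D : ∀ (X : Type u) [NormedAddCommGroup X] [InnerProductSpace ℝ X] [FiniteDimensional ℝ X],
      Submodule ℤ X → Submodule ℝ X → PointedCone ℝ X → ℕ → ((X → ℂ) → X → ℂ))
    -- homogeneity
    (hD : ∀ (X : Type u) [NormedAddCommGroup X] [InnerProductSpace ℝ X] [FiniteDimensional ℝ X]
      (Λ : Submodule ℤ X) (L : Submodule ℝ X) (C : PointedCone ℝ X) (n : ℕ),
      IsRationalSpace Λ → IsRationalSubspace Λ L →
      IsUnimodular (quotLattice Λ L) C →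
      coneDim C ≤ n →
      IsHomogeneousOperator (n - coneDim C) (D X Λ L C n))
    -- condition 1: compatibility with orthogonal projections
    (h1 : ∀ (X : Type u) [NormedAddCommGroup X] [InnerProductSpace ℝ X] [FiniteDimensional ℝ X]
      (Λ : Submodule ℤ X) (L : Submodule ℝ X) (C : PointedCone ℝ X) (n : ℕ),
      IsRationalSpace Λ → IsRationalSubspace Λ L →
      IsUnimodular (quotLattice Λ L) C →
      coneDim C ≤ n → ∀ ξ : StrongDual ℝ X,
      symbol (D X Λ L C n) ξ =
        symbol
          (D Lᗮ (latticeIn (quotLattice Λ L) Lᗮ) ⊥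
            (coneIn C Lᗮ) n) (ξ ∘L Lᗮ.subtypeL))
    -- condition 2: compatibility with restriction to the span of a cone
    (h2 : ∀ (X : Type u) [NormedAddCommGroup X] [InnerProductSpace ℝ X] [FiniteDimensional ℝ X]
      (Λ : Submodule ℤ X) (C : PointedCone ℝ X) (n : ℕ),
      IsRationalSpace Λ → IsUnimodular Λ C →
      coneDim C < Module.finrank ℝ X →
      coneDim C ≤ n → ∀ ξ : StrongDual ℝ X,
      symbol (D X Λ ⊥ C n) ξ =
        symbol
          (D (coneSpan C) (latticeIn Λ (coneSpan C)) ⊥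
            (coneIn C (coneSpan C)) n)
          (ξ ∘L (coneSpan C).subtypeL))
    -- condition 3: normalization in dimensions zero and one
    (h3_zero : ∀ (X : Type u) [NormedAddCommGroup X] [InnerProductSpace ℝ X]
      [FiniteDimensional ℝ X] (Λ : Submodule ℤ X),
      IsRationalSpace Λ → Module.finrank ℝ X = 0 →
      ∀ f : X → ℂ, ContDiff ℝ ∞ f →
        D X Λ ⊥ ⊥ 0 f = f ∧ ∀ n : ℕ, 1 ≤ n → D X Λ ⊥ ⊥ n f = 0)
    (h3_one : ∀ (X : Type u) [NormedAddCommGroup X] [InnerProductSpace ℝ X]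
      [FiniteDimensional ℝ X] (Λ : Submodule ℤ X) (e : X),
      IsRationalSpace Λ → Module.finrank ℝ X = 1 →
      Submodule.span ℤ {e} = Λ → ∀ n : ℕ, 1 ≤ n →
      ∀ f : X → ℂ, ContDiff ℝ ∞ f → ∀ x : X,
        D X Λ ⊥ (PointedCone.hull ℝ {e}) n f x =
          -((bernoulli n : ℂ) / (n.factorial : ℂ)) *
            iteratedFDeriv ℝ (n - 1) f x (fun _ => e))
    -- condition 4: the asymptotic expansion of the Riemann sums
    (h4 : ∀ (X : Type u) [NormedAddCommGroup X] [InnerProductSpace ℝ X] [FiniteDimensional ℝ X]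
      (Λ : Submodule ℤ X) (C : PointedCone ℝ X),
      IsRationalSpace Λ → IsUnimodular Λ C →
      ∀ φ : SchwartzMap X ℂ,
        HasAsymptoticExpansion (riemannSum Λ C φ)
          (fun n => ∑ᶠ (F : PointedCone ℝ X)
            (_ : F.IsFaceOf C ∧ coneDim C ≤ coneDim F + n),
            coneIntegral Λ F
              (D X Λ (coneSpan F)
                (C.map (perpProj (coneSpan F))) n φ))) :
    ∀ (X : Type u) [NormedAddCommGroup X] [InnerProductSpace ℝ X] [FiniteDimensional ℝ X]
      (Λ : Submodule ℤ X), IsRationalSpace Λ →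
      (∃ μ : (L : Submodule ℝ X) → PointedCone ℝ X → StrongDual ℝ Lᗮ → ℝ,
        IsBerlineVergneFamily Λ μ) ∧
      ∀ μ : (L : Submodule ℝ X) → PointedCone ℝ X → StrongDual ℝ Lᗮ → ℝ,
        IsBerlineVergneFamily Λ μ →
        ∀ (L : Submodule ℝ X) (C : PointedCone ℝ X) (n : ℕ),
          IsRationalSubspace Λ L →
          IsUnimodular (quotLattice Λ L) C →
          coneDim C ≤ n → ∀ ξ : StrongDual ℝ X,
          symbol (D X Λ L C n) ξ =
            ((homogeneousPart (n - coneDim C) (μ L C)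
              (ξ ∘L Lᗮ.subtypeL) : ℝ) : ℂ) := by
  intro X _ _ _ Λ hΛ
  have hA : EulerMaclaurin.IsAdmissible D := ⟨hD, h1, h4⟩
  exact ⟨hA.exists_isBerlineVergneFamily hΛ, fun μ hμ L C n hL hC hn ξ =>
    hA.symbol_eq_homogeneousPart hΛ hμ hL hC hn ξ⟩
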